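/- For every integer $n \ge 0$ there is a constant $C_n$, depending only on $n$, such that the following holds. Let $(M^n,g)$ be a closed (compact, without boundary) smooth Riemannian manifold of dimension $n$ with Riemannian volume measure $dV$, let $\theta$ be a closed smooth real one-form on $M$, and let $X$ be the vector field dual to $\theta$, i.e. $g(X,Y)=\theta(Y)$ for all $Y$. Let $d_\theta\alpha = d\alpha+\theta\wedge\alpha$ on smooth real forms, let $d_\theta^*$ be the formal $L^2$ adjoint of $d_\theta$ with respect to $g$, and let $\Delta_\theta = d_\theta d_\theta^*+d_\theta^*d_\theta$. Then for every $p \ge 0$ and every smooth real $p$-form $\alpha$ with $\Delta_\theta\alpha=0$, $$\int_M |X|^2|\alpha|^2\,dV \;\le\; C_n\int_M \bigl(|\nabla X|+|\operatorname{div} X|\bigr)|\alpha|^2\,dV ,$$ where $\nabla$ is the Levi-Civita connection of $g$, $|\nabla X|$ is the Hilbert-Schmidt norm of $\nabla X$, $\operatorname{div}X=\operatorname{Tr}\nabla X$ is the divergence, and $|\alpha|$ is the pointwise norm on $p$-forms induced by $g$. -/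

import Mathlib

open scoped Manifold ContDiff

noncomputable section

namespace MorseNovikov

/-- A smooth Riemannian metric on the `n`-manifold `M`. -/
abbrev Metric (n : ℕ) (M : Type*) [TopologicalSpace M] [ChartedSpace (EuclideanSpace ℝ (Fin n)) M]
    [IsManifold (𝓡 n) ∞ M] :=
  Bundle.ContMDiffRiemannianMetric (𝓡 n) ∞ (EuclideanSpace ℝ (Fin n))
    (fun x : M => TangentSpace (𝓡 n) x)

/-- A (not necessarily smooth) real `p`-form on `M`: an alternating `p`-linear form on every tangent
space. -/
abbrev Form (n : ℕ) (M : Type*) [TopologicalSpace M] [ChartedSpace (EuclideanSpace ℝ (Fin n)) M]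
    (p : ℕ) :=
  (x : M) → (TangentSpace (𝓡 n) x) [⋀^Fin p]→L[ℝ] ℝ

section Charts

variable {n : ℕ} {M : Type*} [TopologicalSpace M] [ChartedSpace (EuclideanSpace ℝ (Fin n)) M]

/-- The `i`-th standard basis vector of `ℝⁿ`. -/
def stdVec (i : Fin n) : EuclideanSpace ℝ (Fin n) := EuclideanSpace.single i 1

/-- The derivative `ℝⁿ → T M` at `y` of the inverse of the chart `φ` around `x₀`. -/
def chartSymmDeriv (x₀ : M) (y : EuclideanSpace ℝ (Fin n)) :
    EuclideanSpace ℝ (Fin n) →L[ℝ] TangentSpace (𝓡 n) ((extChartAt (𝓡 n) x₀).symm y) :=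
  mfderiv (𝓡 n) (𝓡 n) (extChartAt (𝓡 n) x₀).symm y

/-- The derivative `T_x M → ℝⁿ` at `x` of the chart `φ` around `x₀`. -/
def chartDeriv (x₀ x : M) : TangentSpace (𝓡 n) x →L[ℝ] EuclideanSpace ℝ (Fin n) :=
  mfderiv (𝓡 n) (𝓡 n) (extChartAt (𝓡 n) x₀) x

/-- The expression `(φ⁻¹)^* σ` of a `p`-form in the chart `φ` around `x₀`. -/
def formRep {p : ℕ} (σ : Form n M p) (x₀ : M) (y : EuclideanSpace ℝ (Fin n)) :
    (EuclideanSpace ℝ (Fin n)) [⋀^Fin p]→L[ℝ] ℝ :=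
  (σ ((extChartAt (𝓡 n) x₀).symm y)).compContinuousLinearMap (chartSymmDeriv x₀ y)

/-- A form is smooth if its expressions in the charts are smooth. -/
def IsSmooth {p : ℕ} (σ : Form n M p) : Prop :=
  ∀ x₀ : M, ContDiffOn ℝ ∞ (formRep σ x₀) (extChartAt (𝓡 n) x₀).target

/-- The exterior derivative, computed at `x` in the chart around `x`. -/
def extDer {p : ℕ} (σ : Form n M p) : Form n M (p + 1) := fun x =>
  (extDeriv (formRep σ x) (extChartAt (𝓡 n) x x)).compContinuousLinearMap (chartDeriv x x)

/-- The wedge product of a covector `a` with an alternating form `b`: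
`(a ∧ b)(v₀, …, v_p) = ∑ i, (-1)^i a(v_i) b(v₀, …, v̂_i, …, v_p)`. -/
def wedgeCovector {p : ℕ} (a : (EuclideanSpace ℝ (Fin n)) [⋀^Fin 1]→L[ℝ] ℝ)
    (b : (EuclideanSpace ℝ (Fin n)) [⋀^Fin p]→L[ℝ] ℝ) :
    (EuclideanSpace ℝ (Fin n)) [⋀^Fin (p + 1)]→L[ℝ] ℝ :=
  ContinuousAlternatingMap.alternatizeUncurryFin
    (((ContinuousAlternatingMap.ofSubsingleton ℝ (EuclideanSpace ℝ (Fin n)) ℝ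
      (0 : Fin 1)).symm a).smulRight b)

/-- The wedge product `θ ∧ σ` of a one-form and a `p`-form. -/
def wedge {p : ℕ} (θ : Form n M 1) (σ : Form n M p) : Form n M (p + 1) := fun x =>
  wedgeCovector (θ x) (σ x)

/-- The twisted differential `d_θ σ = d σ + θ ∧ σ`. -/
def twistedD {p : ℕ} (θ : Form n M 1) (σ : Form n M p) : Form n M (p + 1) := fun x =>
  extDer σ x + wedge θ σ x

/-- The basis of `T_x M` given by the coordinate vectors at `x` of the chart around `x`; Mathlib's
`TangentSpace` identifies `T_x M` with `ℝⁿ` through this basis. -/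
def frame (x : M) (i : Fin n) : TangentSpace (𝓡 n) x := stdVec i

/-- The expression of a vector field in the chart around `x₀`. -/
def vecRep (X : (x : M) → TangentSpace (𝓡 n) x) (x₀ : M) (y : EuclideanSpace ℝ (Fin n)) :
    EuclideanSpace ℝ (Fin n) :=
  chartDeriv x₀ ((extChartAt (𝓡 n) x₀).symm y) (X ((extChartAt (𝓡 n) x₀).symm y))

end Charts

section Riemannian

variable {n : ℕ} {M : Type*} [TopologicalSpace M] [ChartedSpace (EuclideanSpace ℝ (Fin n)) M]
  [IsManifold (𝓡 n) ∞ M]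

/-- The inverse `(g^{ij})` of the Gram matrix of the metric at `x` in the basis `frame x`. -/
def gramInv (g : Metric n M) (x : M) : Matrix (Fin n) (Fin n) ℝ :=
  (Matrix.of fun i j => g.inner x (frame x i) (frame x j))⁻¹

/-- The pointwise inner product of `p`-forms induced by `g`:
`⟨α, β⟩ = (1 / p!) ∑ g^{i₁j₁} ⋯ g^{i_pj_p} α_{i₁…i_p} β_{j₁…j_p}`. It does not depend on the basis
of the tangent space, and `e^{i₁} ∧ ⋯ ∧ e^{i_p}`, `i₁ < ⋯ < i_p`, is orthonormal whenever
`e₁, …, e_n` is. -/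
def formInner {p : ℕ} (g : Metric n M) (α β : Form n M p) (x : M) : ℝ :=
  (p.factorial : ℝ)⁻¹ * ∑ I : Fin p → Fin n, ∑ J : Fin p → Fin n,
    (∏ k, gramInv g x (I k) (J k)) * α x (fun k => frame x (I k)) * β x (fun k => frame x (J k))

/-- The matrix `(g_{ij})` of the metric in the chart around `x₀`. -/
def metricRep (g : Metric n M) (x₀ : M) (y : EuclideanSpace ℝ (Fin n)) :
    Matrix (Fin n) (Fin n) ℝ :=
  Matrix.of fun i j => g.inner ((extChartAt (𝓡 n) x₀).symm y)
    (chartSymmDeriv x₀ y (stdVec i)) (chartSymmDeriv x₀ y (stdVec j))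

/-- The partial derivative `∂_k g_{ij}` in the chart around `x₀`. -/
def metricPartial (g : Metric n M) (x₀ : M) (y : EuclideanSpace ℝ (Fin n)) (k i j : Fin n) : ℝ :=
  fderiv ℝ (fun z => metricRep g x₀ z i j) y (stdVec k)

/-- The Christoffel symbol `Γ^k_{ij}` of the Levi-Civita connection in the chart around `x₀`. -/
def christoffel (g : Metric n M) (x₀ : M) (y : EuclideanSpace ℝ (Fin n)) (k i j : Fin n) : ℝ :=
  2⁻¹ * ∑ l, (metricRep g x₀ y)⁻¹ k l *
    (metricPartial g x₀ y i j l + metricPartial g x₀ y j i l - metricPartial g x₀ y l i j)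

/-- The component `(∇_i X)^k = ∂_i X^k + ∑ j, Γ^k_{ij} X^j` of the Levi-Civita covariant derivative
of a vector field at `x`, in the chart around `x`. -/
def covDeriv (g : Metric n M) (X : (x : M) → TangentSpace (𝓡 n) x) (x : M) (k i : Fin n) : ℝ :=
  fderiv ℝ (fun z => vecRep X x z k) (extChartAt (𝓡 n) x x) (stdVec i) +
    ∑ j, christoffel g x (extChartAt (𝓡 n) x x) k i j * vecRep X x (extChartAt (𝓡 n) x x) j

/-- The norm `|∇X| = (∑ g^{ij} g_{kl} (∇_i X)^k (∇_j X)^l)^{1/2}` at `x`. -/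
def gradNorm (g : Metric n M) (X : (x : M) → TangentSpace (𝓡 n) x) (x : M) : ℝ :=
  Real.sqrt (∑ i, ∑ j, ∑ k, ∑ l,
    (metricRep g x (extChartAt (𝓡 n) x x))⁻¹ i j * metricRep g x (extChartAt (𝓡 n) x x) k l *
      covDeriv g X x k i * covDeriv g X x l j)

/-- The divergence of a vector field: the trace of `∇X`. -/
def divergence (g : Metric n M) (X : (x : M) → TangentSpace (𝓡 n) x) (x : M) : ℝ :=
  ∑ i, covDeriv g X x i i

/-- The measure on `M` that lives on the domain of the chart around `x₀` and is
`√(det g_{ij}) dy¹ ⋯ dyⁿ` there. -/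
def chartVolume [MeasurableSpace M] (g : Metric n M) (x₀ : M) : MeasureTheory.Measure M :=
  (((MeasureTheory.volume : MeasureTheory.Measure (EuclideanSpace ℝ (Fin n))).restrict
    (extChartAt (𝓡 n) x₀).target).withDensity
      (fun y => ENNReal.ofReal (Real.sqrt (metricRep g x₀ y).det))).map (extChartAt (𝓡 n) x₀).symm

/-- The Riemannian volume measure `dV`. The measures `chartVolume g x₀` agree on the overlaps of the
charts, and their supremum in the lattice of measures is the measure on `M` whose restriction to the
domain of every chart is the volume in that chart. -/
def riemannianVolume [MeasurableSpace M] (g : Metric n M) : MeasureTheory.Measure M :=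
  ⨆ x₀ : M, chartVolume g x₀

/-- The `p`-form `β` is `d_θ^* α`, where `d_θ^*` is the formal `L²` adjoint of `d_θ`: it is the
(unique) smooth form with `∫ ⟨d_θ γ, α⟩ dV = ∫ ⟨γ, β⟩ dV` for all smooth `p`-forms `γ`. (`M` is
compact in the application, so that all smooth forms are test forms.) -/
def IsAdjoint [MeasurableSpace M] {p : ℕ} (g : Metric n M) (θ : Form n M 1)
    (α : Form n M (p + 1)) (β : Form n M p) : Prop :=
  IsSmooth β ∧ ∀ γ : Form n M p, IsSmooth γ →
    ∫ x, formInner g (twistedD θ γ) α x ∂(riemannianVolume g) =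
      ∫ x, formInner g γ β x ∂(riemannianVolume g)

/-- The `p`-form `L` is `Δ_θ α = d_θ d_θ^* α + d_θ^* d_θ α`. On functions `d_θ^*` vanishes. -/
def IsLaplacian [MeasurableSpace M] (g : Metric n M) (θ : Form n M 1) :
    {p : ℕ} → Form n M p → Form n M p → Prop
  | 0, α, L => IsAdjoint g θ (twistedD θ α) L
  | _ + 1, α, L => ∃ β η, IsAdjoint g θ α β ∧ IsAdjoint g θ (twistedD θ α) η ∧
      L = fun x => twistedD θ β x + η x

/-- `α` is a smooth form with `Δ_θ α = 0`. -/
def IsHarmonic [MeasurableSpace M] {p : ℕ} (g : Metric n M) (θ : Form n M 1)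
    (α : Form n M p) : Prop :=
  IsSmooth α ∧ IsLaplacian g θ α (fun _ => 0)

end Riemannian

end MorseNovikov

end

/-! Pairing Δ_θ α = 0 with α gives ‖d_θ α‖² + ‖d_θ^* α‖² = 0, so both terms vanish almost
everywhere. Two consequences are used: ⟨ι_X d_θ α, α⟩ = 0 almost everywhere, and ∫⟨d_θ(ι_X α), α⟩ =
∫⟨ι_X α, d_θ^* α⟩ = 0. Their sum contains ι_X d + d ι_X, which is the Lie derivative by Cartan's
formula, and ι_X(θ ∧ α) + θ ∧ ι_X α = |X|² α. Hence ∫|X|²|α|² = -∫⟨L_X α, α⟩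
(`IsHarmonic.exists_integral_identity`).

The Lie derivative differs from the covariant derivative by the action of ∇X as a derivation on the
slots of α, and ∇ is metric, so ⟨L_X α, α⟩ = ½ X|α|² + ⟨∇X · α, α⟩ (`lie_derivative_identity`). The
first term integrates to -½ ∫|α|² div X by the divergence theorem (`integral_dirDeriv_add`). The
second is at most p n |∇X||α|², by looking at matrix entries in an orthonormal frame
(`abs_contract_act_le`). Forms of degree above n vanish, so p ≤ n may be assumed and the constant n²
+ 1 serves for all degrees.

Everything is computed in charts. Since θ is closed, ∇X with its index lowered is half the Lie
derivative of the metric (`transpose_covMat_mul`). This one fact replaces the transformation law of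
the Christoffel symbols: the Lie derivative of g is tensorial, hence so is ∇X, and the derivative of
g along X is expressed through ∇X and the Jacobian of X. -/

open scoped Manifold ContDiff

noncomputable section

namespace MorseNovikov

/-! ### Linear algebra of alternating forms on ℝⁿ: matrices of endomorphisms -/

section Algebra

open Matrix

variable {n p : ℕ}

/-- The coordinate space. -/
abbrev Coord (n : ℕ) := EuclideanSpace ℝ (Fin n)

/-- The matrix of an endomorphism of `ℝⁿ`. -/
def matOf (L : Coord n →L[ℝ] Coord n) : Matrix (Fin n) (Fin n) ℝ :=
  Matrix.of fun i j => L (stdVec j) i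

theorem sum_smul_stdVec (v : Coord n) : ∑ i, v i • stdVec i = v := by
  ext j
  simp [stdVec, Pi.single_apply]

theorem stdVec_apply (i j : Fin n) : (stdVec i : Coord n) j = if j = i then 1 else 0 := by
  simp [stdVec]

theorem map_stdVec (L : Coord n →L[ℝ] Coord n) (j : Fin n) :
    L (stdVec j) = ∑ i, matOf L i j • stdVec i := by
  rw [← sum_smul_stdVec (L (stdVec j))]
  rfl

theorem apply_eq_sum_matOf (L : Coord n →L[ℝ] Coord n) (v : Coord n) (i : Fin n) :
    L v i = ∑ j, matOf L i j * v j := by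
  conv_lhs => rw [← sum_smul_stdVec v]
  simp [matOf, mul_comm]

theorem matOf_comp (L K : Coord n →L[ℝ] Coord n) : matOf (L ∘L K) = matOf L * matOf K := by
  ext i j
  exact apply_eq_sum_matOf L (K (stdVec j)) i

theorem matOf_id : matOf (ContinuousLinearMap.id ℝ (Coord n)) = 1 := by
  ext i j
  simp [matOf, stdVec_apply, Matrix.one_apply]

/-- The endomorphism of `ℝⁿ` with a given matrix. -/
def ofMat (A : Matrix (Fin n) (Fin n) ℝ) : Coord n →L[ℝ] Coord n :=
  Matrix.toEuclideanCLM (𝕜 := ℝ) A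

theorem matOf_ofMat (A : Matrix (Fin n) (Fin n) ℝ) : matOf (ofMat A) = A := by
  ext i j
  simp [matOf, ofMat, stdVec]

theorem ofMat_matOf (L : Coord n →L[ℝ] Coord n) : ofMat (matOf L) = L := by
  ext v i
  rw [apply_eq_sum_matOf, matOf_ofMat, apply_eq_sum_matOf]

theorem matOf_add (L K : Coord n →L[ℝ] Coord n) : matOf (L + K) = matOf L + matOf K := by
  ext i j; simp [matOf]

theorem matOf_sub (L K : Coord n →L[ℝ] Coord n) : matOf (L - K) = matOf L - matOf K := by
  ext i j; simp [matOf]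

/-! ### Contraction of forms against a matrix, and its behaviour under change of basis -/

/-- The contraction `∑ H^{i₁j₁} ⋯ H^{i_pj_p} u_{i₁…i_p} w_{j₁…j_p}`. -/
def contract (H : Matrix (Fin n) (Fin n) ℝ) (u w : (Fin p → Coord n) → ℝ) : ℝ :=
  ∑ I : Fin p → Fin n, ∑ J : Fin p → Fin n,
    (∏ k, H (I k) (J k)) * u (fun k => stdVec (I k)) * w (fun k => stdVec (J k))

variable (H : Matrix (Fin n) (Fin n) ℝ)

theorem contract_add_left (u u' w : (Fin p → Coord n) → ℝ) :
    contract H (fun v => u v + u' v) w = contract H u w + contract H u' w := by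
  simp only [contract, mul_add, add_mul, Finset.sum_add_distrib]

theorem contract_add_right (u w w' : (Fin p → Coord n) → ℝ) :
    contract H u (fun v => w v + w' v) = contract H u w + contract H u w' := by
  simp only [contract, mul_add, Finset.sum_add_distrib]

theorem contract_smul_left (c : ℝ) (u w : (Fin p → Coord n) → ℝ) :
    contract H (fun v => c * u v) w = c * contract H u w := by
  simp only [contract, Finset.mul_sum]
  refine Finset.sum_congr rfl fun I _ => Finset.sum_congr rfl fun J _ => by ring

theorem contract_smul_right (c : ℝ) (u w : (Fin p → Coord n) → ℝ) :
    contract H u (fun v => c * w v) = c * contract H u w := by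
  simp only [contract, Finset.mul_sum]
  refine Finset.sum_congr rfl fun I _ => Finset.sum_congr rfl fun J _ => by ring

theorem contract_sum_left {ι : Type*} (s : Finset ι) (u : ι → (Fin p → Coord n) → ℝ)
    (w : (Fin p → Coord n) → ℝ) :
    contract H (fun v => ∑ i ∈ s, u i v) w = ∑ i ∈ s, contract H (u i) w := by
  simp only [contract, Finset.mul_sum, Finset.sum_mul]
  rw [Finset.sum_comm (s := s)]
  exact Finset.sum_congr rfl fun I _ => Finset.sum_comm

theorem contract_sum_right {ι : Type*} (s : Finset ι) (u : (Fin p → Coord n) → ℝ)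
    (w : ι → (Fin p → Coord n) → ℝ) :
    contract H u (fun v => ∑ i ∈ s, w i v) = ∑ i ∈ s, contract H u (w i) := by
  simp only [contract, Finset.mul_sum]
  rw [Finset.sum_comm (s := s)]
  exact Finset.sum_congr rfl fun I _ => Finset.sum_comm

theorem contract_comm (u w : (Fin p → Coord n) → ℝ) : contract H u w = contract Hᵀ w u := by
  rw [contract, Finset.sum_comm, contract]
  refine Finset.sum_congr rfl fun I _ => Finset.sum_congr rfl fun J _ => ?_
  simp only [Matrix.transpose_apply]
  ring

/-- Separates the k-th index of both multi-indices. Slot 0 drives the inductions on the degree; an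
arbitrary slot is needed for the wedge product. -/
theorem contract_insertNth (k : Fin (p + 1)) (u w : (Fin (p + 1) → Coord n) → ℝ) :
    contract H u w = ∑ i, ∑ j, H i j *
      contract H (fun v => u (k.insertNth (stdVec i) v))
        (fun v => w (k.insertNth (stdVec j) v)) := by
  have key : ∀ (i : Fin n) (I : Fin p → Fin n),
      (fun l => (stdVec ((k.insertNth i I : Fin (p + 1) → Fin n) l) : Coord n)) =
        k.insertNth (α := fun _ => Coord n) (stdVec i) (fun l => stdVec (I l)) := by
    intro i I
    refine (Fin.eq_insertNth_iff).2 ⟨by simp, ?_⟩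
    funext l
    simp [Fin.removeNth]
  rw [contract, ← (Fin.insertNthEquiv (fun _ => Fin n) k).sum_comp, Fintype.sum_prod_type]
  refine Finset.sum_congr rfl fun i _ => ?_
  simp_rw [← (Fin.insertNthEquiv (fun _ => Fin n) k).sum_comp (fun J => _ * _),
    Fintype.sum_prod_type]
  rw [Finset.sum_comm]
  refine Finset.sum_congr rfl fun j _ => ?_
  simp only [contract, Finset.mul_sum]
  refine Finset.sum_congr rfl fun I _ => Finset.sum_congr rfl fun J _ => ?_
  simp only [Fin.insertNthEquiv_apply, key, Fin.prod_univ_succAbove _ k, Fin.insertNth_apply_same,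
    Fin.insertNth_apply_succAbove]
  ring

theorem contract_succ (u w : (Fin (p + 1) → Coord n) → ℝ) :
    contract H u w = ∑ i, ∑ j, H i j *
      contract H (fun v => u (Fin.cons (stdVec i) v)) (fun v => w (Fin.cons (stdVec j) v)) := by
  rw [contract_insertNth H 0]
  simp only [Fin.insertNth_zero']

theorem contract_curryLeft (a b : Coord n [⋀^Fin (p + 1)]→L[ℝ] ℝ) :
    contract H a b = ∑ i, ∑ j, H i j *
      contract H (a.curryLeft (stdVec i)) (b.curryLeft (stdVec j)) :=
  contract_succ H a b

theorem contract_map_left {p : ℕ} (a : Coord n [⋀^Fin (p + 1)]→L[ℝ] ℝ)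
    (L : Coord n →L[ℝ] Coord n) (w : (Fin p → Coord n) → ℝ) (j : Fin n) :
    contract H (a.curryLeft (L (stdVec j))) w =
      ∑ i, matOf L i j * contract H (a.curryLeft (stdVec i)) w := by
  simp only [← contract_smul_left, ← contract_sum_left]
  congr 1
  funext v
  rw [map_stdVec]
  simp

theorem contract_map_right {p : ℕ} (a : Coord n [⋀^Fin (p + 1)]→L[ℝ] ℝ)
    (L : Coord n →L[ℝ] Coord n) (w : (Fin p → Coord n) → ℝ) (j : Fin n) :
    contract H w (a.curryLeft (L (stdVec j))) =
      ∑ i, matOf L i j * contract H w (a.curryLeft (stdVec i)) := by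
  simp only [← contract_smul_right, ← contract_sum_right]
  congr 1
  funext v
  rw [map_stdVec]
  simp

/-- Both sides are traces of cyclic rearrangements of the same product of matrices. -/
theorem sum_congr_mul (A B : Matrix (Fin n) (Fin n) ℝ) (c : Fin n → Fin n → ℝ) :
    ∑ i, ∑ j, (A * B * Aᵀ) i j * c i j =
      ∑ k, ∑ l, B k l * ∑ j, A j l * ∑ i, A i k * c i j := by
  have h1 : ∑ i, ∑ j, (A * B * Aᵀ) i j * c i j = (A * B * Aᵀ * (Matrix.of c)ᵀ).trace := by
    simp [Matrix.trace, Matrix.mul_apply (M := A * B * Aᵀ)]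
  have h2 : ∑ k, ∑ l, B k l * ∑ j, A j l * ∑ i, A i k * c i j =
      (B * (Aᵀ * ((Matrix.of c)ᵀ * A))).trace := by
    simp [Matrix.trace, Matrix.mul_apply, mul_comm]
  rw [h1, h2, Matrix.mul_assoc, Matrix.mul_assoc, Matrix.trace_mul_comm]
  simp only [Matrix.mul_assoc]

/-- Tensoriality of the contraction, by induction on the degree: one slot at a time, L moves from
the forms to the matrix. Chart independence of the inner product of forms rests on it. -/
theorem contract_congr_matrix (L : Coord n →L[ℝ] Coord n) (K : Matrix (Fin n) (Fin n) ℝ)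
    (a b : Coord n [⋀^Fin p]→L[ℝ] ℝ) :
    contract (matOf L * K * (matOf L)ᵀ) a b =
      contract K (a.compContinuousLinearMap L) (b.compContinuousLinearMap L) := by
  induction p with
  | zero =>
    simp only [contract, Finset.univ_unique, Finset.sum_singleton, Finset.univ_eq_empty,
      Finset.prod_empty]
    simp only [ContinuousAlternatingMap.compContinuousLinearMap_apply]
    congr 2 <;> first
      | exact Subsingleton.elim (α := Fin 0 → Coord n) _ _
      | exact congrArg a (Subsingleton.elim (α := Fin 0 → Coord n) _ _)
  | succ p ih =>
    rw [contract_curryLeft, contract_curryLeft]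
    have h : ∀ (c : Coord n [⋀^Fin (p + 1)]→L[ℝ] ℝ) (m : Fin n),
        (c.compContinuousLinearMap L).curryLeft (stdVec m) =
          (c.curryLeft (L (stdVec m))).compContinuousLinearMap L := by
      intro c m; rw [ContinuousAlternatingMap.curryLeft_compContinuousLinearMap]
    simp only [h, ← ih]
    simp only [contract_map_left, contract_map_right]
    exact sum_congr_mul _ _ fun i j =>
      contract (matOf L * K * (matOf L)ᵀ) (a.curryLeft (stdVec i)) (b.curryLeft (stdVec j))

/-! ### Endomorphisms acting on forms as derivations -/

/-- The action `∑ k, u(v₁, …, Γ v_k, …, v_p)` of an endomorphism. -/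
def act (Γ : Coord n →L[ℝ] Coord n) (u : (Fin p → Coord n) → ℝ) (v : Fin p → Coord n) : ℝ :=
  ∑ k, u (Function.update v k (Γ (v k)))

theorem act_cons (Γ : Coord n →L[ℝ] Coord n) (u : (Fin (p + 1) → Coord n) → ℝ) (x : Coord n)
    (w : Fin p → Coord n) :
    act Γ u (Fin.cons x w) = u (Fin.cons (Γ x) w) + act Γ (fun w => u (Fin.cons x w)) w := by
  simp [act, Fin.sum_univ_succ, Fin.cons_update]

/-- Moving Γ v_k from the front into slot k costs the sign (-1)^k, which is exactly the sign in the
alternatization. In particular the action on an alternating form is again alternating. -/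
theorem alternatizeUncurryFin_curryLeft_comp (a : Coord n [⋀^Fin (p + 1)]→L[ℝ] ℝ)
    (Γ : Coord n →L[ℝ] Coord n) (v : Fin (p + 1) → Coord n) :
    ContinuousAlternatingMap.alternatizeUncurryFin (a.curryLeft ∘L Γ) v = act Γ a v := by
  rw [ContinuousAlternatingMap.alternatizeUncurryFin_apply, act]
  refine Finset.sum_congr rfl fun k _ => ?_
  rw [← Fin.insertNth_removeNth, ContinuousAlternatingMap.map_insertNth]
  rfl

theorem exists_alternating_eq_act (a : Coord n [⋀^Fin p]→L[ℝ] ℝ) (Γ : Coord n →L[ℝ] Coord n) :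
    ∃ c : Coord n [⋀^Fin p]→L[ℝ] ℝ, ⇑c = act Γ a := by
  cases p with
  | zero => exact ⟨0, by ext v; simp [act]⟩
  | succ p => exact ⟨_, funext (alternatizeUncurryFin_curryLeft_comp a Γ)⟩

theorem sum_mul_contract_map_left (a b : Coord n [⋀^Fin (p + 1)]→L[ℝ] ℝ)
    (Γ : Coord n →L[ℝ] Coord n) :
    ∑ i, ∑ j, H i j * contract H (a.curryLeft (Γ (stdVec i))) (b.curryLeft (stdVec j)) =
      ∑ i, ∑ j, (matOf Γ * H) i j *
        contract H (a.curryLeft (stdVec i)) (b.curryLeft (stdVec j)) := by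
  simp only [contract_map_left, Matrix.mul_apply, Finset.mul_sum, Finset.sum_mul]
  rw [Finset.sum_congr rfl fun i _ => Finset.sum_comm, Finset.sum_comm]
  refine Finset.sum_congr rfl fun i _ => ?_
  rw [Finset.sum_comm]
  refine Finset.sum_congr rfl fun j _ => Finset.sum_congr rfl fun k _ => by ring

theorem sum_mul_contract_map_right (a b : Coord n [⋀^Fin (p + 1)]→L[ℝ] ℝ)
    (Γ : Coord n →L[ℝ] Coord n) :
    ∑ i, ∑ j, H i j * contract H (a.curryLeft (stdVec i)) (b.curryLeft (Γ (stdVec j))) =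
      ∑ i, ∑ j, (H * (matOf Γ)ᵀ) i j *
        contract H (a.curryLeft (stdVec i)) (b.curryLeft (stdVec j)) := by
  simp only [contract_map_right, Matrix.mul_apply, Finset.mul_sum, Finset.sum_mul,
    Matrix.transpose_apply]
  refine Finset.sum_congr rfl fun i _ => ?_
  rw [Finset.sum_comm]
  refine Finset.sum_congr rfl fun j _ => Finset.sum_congr rfl fun k _ => by ring

theorem contract_act_left (a : Coord n [⋀^Fin (p + 1)]→L[ℝ] ℝ)
    (b : Coord n [⋀^Fin (p + 1)]→L[ℝ] ℝ) (Γ : Coord n →L[ℝ] Coord n) :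
    contract H (act Γ a) b =
      ∑ i, ∑ j, (matOf Γ * H) i j *
        contract H (a.curryLeft (stdVec i)) (b.curryLeft (stdVec j)) +
      ∑ i, ∑ j, H i j *
        contract H (act Γ (a.curryLeft (stdVec i))) (b.curryLeft (stdVec j)) := by
  rw [← sum_mul_contract_map_left, contract_succ, ← Finset.sum_add_distrib]
  refine Finset.sum_congr rfl fun i _ => ?_
  rw [← Finset.sum_add_distrib]
  refine Finset.sum_congr rfl fun j _ => ?_
  simp only [act_cons, contract_add_left, mul_add]
  rfl

theorem contract_act_right (a : Coord n [⋀^Fin (p + 1)]→L[ℝ] ℝ)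
    (b : Coord n [⋀^Fin (p + 1)]→L[ℝ] ℝ) (Γ : Coord n →L[ℝ] Coord n) :
    contract H a (act Γ b) =
      ∑ i, ∑ j, (H * (matOf Γ)ᵀ) i j *
        contract H (a.curryLeft (stdVec i)) (b.curryLeft (stdVec j)) +
      ∑ i, ∑ j, H i j *
        contract H (a.curryLeft (stdVec i)) (act Γ (b.curryLeft (stdVec j))) := by
  rw [← sum_mul_contract_map_right, contract_succ, ← Finset.sum_add_distrib]
  refine Finset.sum_congr rfl fun i _ => ?_
  rw [← Finset.sum_add_distrib]
  refine Finset.sum_congr rfl fun j _ => ?_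
  simp only [act_cons, contract_add_right, mul_add]
  rfl

/-- Leibniz rule, by induction on the degree. The hypothesis on H' says that the inverse metric
varies by minus the action of Γ on its two indices, and this is transferred to the two forms; it is
the coordinate version of compatibility of a connection with the metric. -/
theorem hasDerivAt_contract {H : ℝ → Matrix (Fin n) (Fin n) ℝ} {H' : Matrix (Fin n) (Fin n) ℝ}
    {t : ℝ} (Γ : Coord n →L[ℝ] Coord n) (hH : ∀ i j, HasDerivAt (fun s => H s i j) (H' i j) t)
    (hΓ : H' = -(matOf Γ * H t + H t * (matOf Γ)ᵀ)) {a b : ℝ → Coord n [⋀^Fin p]→L[ℝ] ℝ}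
    {a' b' : Coord n [⋀^Fin p]→L[ℝ] ℝ} (ha : HasDerivAt a a' t) (hb : HasDerivAt b b' t) :
    HasDerivAt (fun s => contract (H s) (a s) (b s))
      (contract (H t) a' (b t) + contract (H t) (a t) b' - contract (H t) (act Γ (a t)) (b t) -
        contract (H t) (a t) (act Γ (b t))) t := by
  have happ : ∀ {q : ℕ} {c : ℝ → Coord n [⋀^Fin q]→L[ℝ] ℝ} {c' : Coord n [⋀^Fin q]→L[ℝ] ℝ},
      HasDerivAt c c' t → ∀ v, HasDerivAt (fun s => c s v) (c' v) t := by
    intro q c c' hc v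
    exact (ContinuousAlternatingMap.apply ℝ (Coord n) ℝ v).hasFDerivAt.comp_hasDerivAt t hc
  have hcurry : ∀ {q : ℕ} {c : ℝ → Coord n [⋀^Fin (q + 1)]→L[ℝ] ℝ}
      {c' : Coord n [⋀^Fin (q + 1)]→L[ℝ] ℝ},
      HasDerivAt c c' t → ∀ v, HasDerivAt (fun s => (c s).curryLeft v) (c'.curryLeft v) t := by
    intro q c c' hc v
    exact ((ContinuousLinearMap.apply ℝ (Coord n [⋀^Fin q]→L[ℝ] ℝ) v) ∘L
      ContinuousAlternatingMap.curryLeftLI.toContinuousLinearMap).hasFDerivAt.comp_hasDerivAt t hc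
  induction p with
  | zero =>
    refine (((happ ha fun k => stdVec ((default : Fin 0 → Fin n) k)).fun_mul
      (happ hb fun k => stdVec ((default : Fin 0 → Fin n) k))).congr_deriv ?_).congr_of_eventuallyEq
        ?_
    · simp [contract, act]
    · exact Filter.Eventually.of_forall fun s => by simp [contract]
  | succ p ih =>
    have key := HasDerivAt.fun_sum (u := Finset.univ) fun (i : Fin n) _ =>
      HasDerivAt.fun_sum (u := Finset.univ) fun (j : Fin n) _ =>
        (hH i j).fun_mul (ih (hcurry ha (stdVec i)) (hcurry hb (stdVec j)))
    simp only [contract_curryLeft]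
    refine key.congr_deriv ?_
    rw [contract_act_left, contract_act_right]
    simp only [← Finset.sum_add_distrib, ← Finset.sum_sub_distrib]
    refine Finset.sum_congr rfl fun i _ => Finset.sum_congr rfl fun j _ => ?_
    simp only [hΓ, Matrix.neg_apply, Matrix.add_apply]
    ring

/-! ### Estimates in an orthonormal frame, transported to a general metric -/

theorem contract_one_succ (u w : (Fin (p + 1) → Coord n) → ℝ) :
    contract 1 u w = ∑ i, contract 1 (fun v => u (Fin.cons (stdVec i) v))
      (fun v => w (Fin.cons (stdVec i) v)) := by
  rw [contract_succ]
  simp [Matrix.one_apply]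

theorem contract_one (u w : (Fin p → Coord n) → ℝ) :
    contract 1 u w =
      ∑ I : Fin p → Fin n, u (fun k => stdVec (I k)) * w (fun k => stdVec (I k)) := by
  rw [contract]
  refine Finset.sum_congr rfl fun I _ => ?_
  rw [Finset.sum_eq_single I]
  · simp
  · intro J _ hJ
    obtain ⟨k, hk⟩ := Function.ne_iff.1 hJ
    rw [Finset.prod_eq_zero (Finset.mem_univ k)]
    · simp
    · simp [hk.symm]
  · simp

theorem contract_one_self_nonneg (u : (Fin p → Coord n) → ℝ) : 0 ≤ contract 1 u u := by
  rw [contract_one]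
  exact Finset.sum_nonneg fun I _ => mul_self_nonneg _

theorem abs_contract_one_le (u w : (Fin p → Coord n) → ℝ) :
    |contract 1 u w| ≤ 2⁻¹ * (contract 1 u u + contract 1 w w) := by
  simp only [contract_one, ← Finset.sum_add_distrib, Finset.mul_sum]
  refine (Finset.abs_sum_le_sum_abs _ _).trans (Finset.sum_le_sum fun I _ => ?_)
  rw [abs_le]
  constructor
  · nlinarith [sq_nonneg (u (fun k => stdVec (I k)) + w (fun k => stdVec (I k)))]
  · nlinarith [sq_nonneg (u (fun k => stdVec (I k)) - w (fun k => stdVec (I k)))]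

/-- Each slot costs at most n s. For the first slot, |S_ij| ≤ s and the arithmetic-geometric mean
inequality bound the double sum by s ∑_{i,j} ½(|a_i|² + |a_j|²) = n s |a|², where a_i is a with e_i
inserted; the other slots follow by induction applied to each a_i. -/
theorem abs_contract_one_act_le (S : Coord n →L[ℝ] Coord n) {s : ℝ}
    (hs : ∀ i j, |matOf S i j| ≤ s) (a : Coord n [⋀^Fin p]→L[ℝ] ℝ) :
    |contract 1 (act S a) a| ≤ p * n * s * contract 1 a a := by
  induction p with
  | zero => simp [contract, act]
  | succ p ih =>
    have h1 : contract 1 a a =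
        ∑ i, contract 1 (a.curryLeft (stdVec i)) (a.curryLeft (stdVec i)) := contract_one_succ _ _
    have h2 := contract_act_left 1 a a S
    rw [h2]
    refine (abs_add_le _ _).trans ?_
    have hA : |∑ i, ∑ j, (matOf S * (1 : Matrix (Fin n) (Fin n) ℝ)) i j *
        contract 1 (a.curryLeft (stdVec i)) (a.curryLeft (stdVec j))| ≤ n * s * contract 1 a a := by
      calc _ ≤ ∑ i, ∑ j, s * (2⁻¹ * (contract 1 (a.curryLeft (stdVec i)) (a.curryLeft (stdVec i)) +
                contract 1 (a.curryLeft (stdVec j)) (a.curryLeft (stdVec j)))) := by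
            refine (Finset.abs_sum_le_sum_abs _ _).trans (Finset.sum_le_sum fun i _ => ?_)
            refine (Finset.abs_sum_le_sum_abs _ _).trans (Finset.sum_le_sum fun j _ => ?_)
            rw [abs_mul, mul_one]
            exact mul_le_mul (hs i j) (abs_contract_one_le _ _) (abs_nonneg _)
              ((abs_nonneg _).trans (hs i j))
        _ = _ := by
            simp only [mul_add, Finset.sum_add_distrib, ← Finset.mul_sum, ← h1, Finset.sum_const,
              Finset.card_univ, Fintype.card_fin, nsmul_eq_mul]
            ring
    have hB : |∑ i, ∑ j, (1 : Matrix (Fin n) (Fin n) ℝ) i j *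
        contract 1 (act S (a.curryLeft (stdVec i))) (a.curryLeft (stdVec j))| ≤
          p * n * s * contract 1 a a := by
      rw [h1, Finset.mul_sum]
      refine (Finset.abs_sum_le_sum_abs _ _).trans (Finset.sum_le_sum fun i _ => ?_)
      simpa [Matrix.one_apply] using ih (a.curryLeft (stdVec i))
    push_cast
    linarith

/-- The columns of the matrix of L form an orthonormal basis for the metric with inverse H, so
pulling back by L turns contraction against H into a plain sum over components. -/
theorem exists_matOf_mul_transpose (hH : H.PosDef) :
    ∃ L : Coord n →L[ℝ] Coord n, H = matOf L * (matOf L)ᵀ ∧ IsUnit (matOf L) := by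
  open scoped MatrixOrder ComplexOrder in
  obtain ⟨B, hB⟩ := CStarAlgebra.nonneg_iff_eq_star_mul_self.1
    (Matrix.nonneg_iff_posSemidef.2 hH.posSemidef)
  have hB' : H = Bᵀ * B := by
    rw [hB, Matrix.star_eq_conjTranspose, Matrix.conjTranspose_eq_transpose_of_trivial]
  refine ⟨ofMat Bᵀ, by rw [matOf_ofMat, Matrix.transpose_transpose, hB'], ?_⟩
  rw [matOf_ofMat, Matrix.isUnit_transpose]
  have := hH.isUnit
  rw [hB', Matrix.isUnit_iff_isUnit_det, Matrix.det_mul] at this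
  rw [Matrix.isUnit_iff_isUnit_det]
  exact isUnit_of_mul_isUnit_right this

theorem contract_mul_transpose (L : Coord n →L[ℝ] Coord n) (a b : Coord n [⋀^Fin p]→L[ℝ] ℝ) :
    contract (matOf L * (matOf L)ᵀ) a b =
      contract 1 (a.compContinuousLinearMap L) (b.compContinuousLinearMap L) := by
  rw [← contract_congr_matrix, Matrix.mul_one]

theorem contract_self_nonneg (hH : H.PosDef) (a : Coord n [⋀^Fin p]→L[ℝ] ℝ) :
    0 ≤ contract H a a := by
  obtain ⟨L, rfl, -⟩ := exists_matOf_mul_transpose H hH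
  rw [contract_mul_transpose]
  exact contract_one_self_nonneg _

theorem contract_eq_zero_of_self (hH : H.PosDef) {a : Coord n [⋀^Fin p]→L[ℝ] ℝ}
    (ha : contract H a a = 0) (b : Coord n [⋀^Fin p]→L[ℝ] ℝ) : contract H a b = 0 := by
  obtain ⟨L, rfl, -⟩ := exists_matOf_mul_transpose H hH
  rw [contract_mul_transpose, contract_one] at ha ⊢
  rw [Finset.sum_eq_zero_iff_of_nonneg fun I _ => mul_self_nonneg _] at ha
  refine Finset.sum_eq_zero fun I hI => ?_
  rw [mul_self_eq_zero.1 (ha I hI), zero_mul]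

/-- The squared Hilbert-Schmidt norm of an endomorphism. -/
def hsSq (G : Matrix (Fin n) (Fin n) ℝ) (S : Matrix (Fin n) (Fin n) ℝ) : ℝ :=
  ∑ i, ∑ j, ∑ k, ∑ l, G⁻¹ i j * G k l * S k i * S l j

theorem hsSq_eq_trace (G S : Matrix (Fin n) (Fin n) ℝ) :
    hsSq G S = (G⁻¹ * (Sᵀ * (Gᵀ * S))).trace := by
  simp only [hsSq, Matrix.trace, Matrix.diag, Matrix.mul_apply, Finset.mul_sum,
    Matrix.transpose_apply]
  refine Finset.sum_congr rfl fun i _ => Finset.sum_congr rfl fun j _ => ?_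
  rw [Finset.sum_comm]
  refine Finset.sum_congr rfl fun k _ => Finset.sum_congr rfl fun l _ => by ring

/-- In a G-orthonormal frame the Hilbert-Schmidt norm of S is the Frobenius norm of its matrix,
which dominates every entry; the orthonormal estimate then applies with s equal to that norm. -/
theorem abs_contract_act_le {G : Matrix (Fin n) (Fin n) ℝ} (hG : G.PosDef)
    (S : Coord n →L[ℝ] Coord n) (a : Coord n [⋀^Fin p]→L[ℝ] ℝ) :
    |contract G⁻¹ (act S a) a| ≤ p * n * √(hsSq G (matOf S)) * contract G⁻¹ a a := by
  obtain ⟨L, hL, hu⟩ := exists_matOf_mul_transpose G⁻¹ hG.inv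
  set R := matOf L with hR
  have hdet : IsUnit R.det := (Matrix.isUnit_iff_isUnit_det _).1 hu
  -- T is S written in the orthonormal frame given by the columns of R.
  set T := ofMat (R⁻¹ * matOf S * R) with hT
  have hLT : L ∘L T = S ∘L L := by
    rw [← ofMat_matOf (L ∘L T), ← ofMat_matOf (S ∘L L), matOf_comp, matOf_comp, hT, matOf_ofMat,
      ← hR, ← Matrix.mul_assoc, ← Matrix.mul_assoc, Matrix.mul_nonsing_inv _ hdet, Matrix.one_mul]
  obtain ⟨c, hc⟩ := exists_alternating_eq_act a S
  -- Since L T = S L, pulling back by L carries the action of S to the action of T. The alternating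
  -- form c stands in for `act S a`, because only alternating maps can be pulled back here.
  have hcL : ⇑(c.compContinuousLinearMap L) = act T (a.compContinuousLinearMap L) := by
    ext v
    simp only [ContinuousAlternatingMap.compContinuousLinearMap_apply, hc, act]
    refine Finset.sum_congr rfl fun k _ => congrArg a ?_
    have := congrArg (fun f => f (v k)) hLT
    funext l
    by_cases h : l = k
    · subst h
      simpa using this.symm
    · simp [h]
  have hG' : G = (R⁻¹)ᵀ * R⁻¹ := by
    rw [← Matrix.nonsing_inv_nonsing_inv G ((Matrix.isUnit_iff_isUnit_det _).1 hG.isUnit), hL,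
      Matrix.mul_inv_rev, Matrix.transpose_nonsing_inv]
  have hhs : hsSq G (matOf S) = ∑ i, ∑ j, matOf T i j ^ 2 := by
    have h1 : ∑ i, ∑ j, matOf T i j ^ 2 = ((matOf T)ᵀ * matOf T).trace := by
      simp only [Matrix.trace, Matrix.diag, Matrix.mul_apply, Matrix.transpose_apply, sq]
      rw [Finset.sum_comm]
    rw [hsSq_eq_trace, h1, hL, hG', hT, matOf_ofMat]
    simp only [Matrix.transpose_mul, Matrix.transpose_transpose, Matrix.mul_assoc]
    rw [Matrix.trace_mul_comm]
    simp only [Matrix.mul_assoc]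
  have hs : ∀ i j, |matOf T i j| ≤ √(hsSq G (matOf S)) := by
    intro i j
    rw [hhs]
    refine Real.abs_le_sqrt ?_
    refine le_trans ?_ (Finset.single_le_sum (f := fun i => ∑ j, matOf T i j ^ 2)
      (fun i _ => Finset.sum_nonneg fun j _ => sq_nonneg _) (Finset.mem_univ i))
    exact Finset.single_le_sum (f := fun j => matOf T i j ^ 2)
      (fun j _ => sq_nonneg _) (Finset.mem_univ j)
  rw [← hc, hL, contract_mul_transpose, contract_mul_transpose, hcL]
  exact abs_contract_one_act_le T hs _

/-- Removes the dependence of the constant on the degree: only p ≤ n has to be estimated. -/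
theorem eq_zero_of_lt (hp : n < p) (a : Coord n [⋀^Fin p]→L[ℝ] ℝ) : a = 0 := by
  ext v
  refine a.toAlternatingMap.map_linearDependent v fun h => ?_
  have := h.fintype_card_le_finrank
  simp at this
  omega

/-! ### Wedge product, interior multiplication and Cartan's formula -/

theorem wedgeCovector_apply (θ : Coord n [⋀^Fin 1]→L[ℝ] ℝ) (b : Coord n [⋀^Fin p]→L[ℝ] ℝ)
    (v : Fin (p + 1) → Coord n) :
    wedgeCovector θ b v = ∑ i, (-1) ^ i.val * (θ (fun _ => v i) * b (i.removeNth v)) := by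
  simp [wedgeCovector, ContinuousAlternatingMap.alternatizeUncurryFin_apply]

/-- The metric dual of a covector. -/
def sharp (θ : Coord n [⋀^Fin 1]→L[ℝ] ℝ) : Coord n :=
  WithLp.toLp 2 fun j => ∑ i, H i j * θ (fun _ => stdVec i)

/-- All p + 1 terms of the wedge product contribute equally. The factor p + 1 is later absorbed by
the normalizations 1/p! and 1/(p+1)! of the inner products, making ι_X the adjoint of θ ∧. -/
theorem contract_wedgeCovector (θ : Coord n [⋀^Fin 1]→L[ℝ] ℝ) (b : Coord n [⋀^Fin p]→L[ℝ] ℝ)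
    (a : Coord n [⋀^Fin (p + 1)]→L[ℝ] ℝ) :
    contract H (wedgeCovector θ b) a = (p + 1) * contract H b (a.curryLeft (sharp H θ)) := by
  have h0 : ⇑(wedgeCovector θ b) =
      fun v => ∑ i, (-1) ^ i.val * (θ (fun _ => v i) * b (i.removeNth v)) :=
    funext (wedgeCovector_apply θ b)
  rw [h0, contract_sum_left]
  have h1 : ∀ k : Fin (p + 1), contract H
      (fun v => (-1) ^ k.val * (θ (fun _ => v k) * b (k.removeNth v))) a =
        contract H b (a.curryLeft (sharp H θ)) := by
    intro k
    rw [contract_insertNth H k]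
    have h2 : ⇑(a.curryLeft (sharp H θ)) = fun v => ∑ i, ∑ j, (H i j * θ (fun _ => stdVec i)) *
        a (Fin.cons (stdVec j) v) := by
      funext v
      rw [Finset.sum_comm]
      conv_lhs => rw [← sum_smul_stdVec (sharp H θ)]
      simp [sharp, Finset.sum_mul]
      rfl
    rw [h2]
    simp only [contract_sum_right, contract_smul_right]
    refine Finset.sum_congr rfl fun i _ => Finset.sum_congr rfl fun j _ => ?_
    have h3 : ∀ v : Fin p → Coord n, a (k.insertNth (stdVec j) v) =
        (-1) ^ k.val * a (Fin.cons (stdVec j) v) := by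
      intro v
      rw [ContinuousAlternatingMap.map_insertNth]
      simp
      rfl
    simp only [Fin.insertNth_apply_same, Fin.removeNth_insertNth, h3, contract_smul_left,
      contract_smul_right]
    -- One sign is that of the k-th term of the wedge product, the other comes from moving slot k of
    -- a to the front.
    have : ((-1 : ℝ) ^ k.val) * (-1) ^ k.val = 1 := by
      rw [← mul_pow]; simp
    linear_combination (H i j * θ (fun _ => stdVec i) *
      contract H b fun v => a (Fin.cons (stdVec j) v)) * this
  simp only [h1, Finset.sum_const, Finset.card_univ, Fintype.card_fin, nsmul_eq_mul]
  push_cast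
  ring

/-- Interior multiplication by a vector. -/
def interior (x : Coord n) : (Coord n [⋀^Fin (p + 1)]→L[ℝ] ℝ) →L[ℝ] (Coord n [⋀^Fin p]→L[ℝ] ℝ) :=
  (ContinuousLinearMap.apply ℝ (Coord n [⋀^Fin p]→L[ℝ] ℝ) x) ∘L
    ContinuousAlternatingMap.curryLeftLI.toContinuousLinearMap

theorem interior_apply (x : Coord n) (a : Coord n [⋀^Fin (p + 1)]→L[ℝ] ℝ) :
    interior x a = a.curryLeft x := rfl

/-- In the alternatization at (x, v₀, v₁, …) the term of index 0 is f x v, and the remaining terms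
cancel against the alternatization of ι_x ∘ f, being shifted by one position. Taking f to be the
derivative of a form gives Cartan's formula; taking f = θ ⊗ a gives the anticommutation rule for θ ∧
and ι_x. -/
theorem curryLeft_alternatizeUncurryFin (f : Coord n →L[ℝ] Coord n [⋀^Fin (p + 1)]→L[ℝ] ℝ)
    (x : Coord n) :
    (ContinuousAlternatingMap.alternatizeUncurryFin f).curryLeft x +
      ContinuousAlternatingMap.alternatizeUncurryFin (interior x ∘L f) = f x := by
  ext v
  have h : ∀ i : Fin (p + 1), Fin.removeNth i.succ (Fin.cons x v : Fin (p + 2) → Coord n) =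
      Fin.cons x (i.removeNth v) := by
    intro i
    funext l
    refine Fin.cases ?_ (fun l => ?_) l <;> simp [Fin.removeNth]
  have h1 : (ContinuousAlternatingMap.alternatizeUncurryFin f) (Fin.cons x v) +
      ContinuousAlternatingMap.alternatizeUncurryFin (interior x ∘L f) v = f x v := by
    rw [ContinuousAlternatingMap.alternatizeUncurryFin_apply,
      ContinuousAlternatingMap.alternatizeUncurryFin_apply, Fin.sum_univ_succ (n := p + 1),
      add_assoc, ← Finset.sum_add_distrib, Finset.sum_eq_zero]
    · simp [Fin.removeNth_zero]
    · intro i _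
      rw [h, Fin.val_succ, Fin.cons_succ, pow_succ]
      have : (interior x ∘L f) (v i) (i.removeNth v) = f (v i) (Fin.cons x (i.removeNth v)) := rfl
      rw [this]
      simp
  exact h1

theorem curryLeft_alternatizeUncurryFin_zero (f : Coord n →L[ℝ] Coord n [⋀^Fin 0]→L[ℝ] ℝ)
    (x : Coord n) :
    (ContinuousAlternatingMap.alternatizeUncurryFin f).curryLeft x = f x := by
  ext v
  have h1 : (ContinuousAlternatingMap.alternatizeUncurryFin f) (Fin.cons x v) = f x v := by
    rw [ContinuousAlternatingMap.alternatizeUncurryFin_apply]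
    simp [Fin.removeNth_zero]
  exact h1

theorem curryLeft_wedgeCovector (θ : Coord n [⋀^Fin 1]→L[ℝ] ℝ)
    (a : Coord n [⋀^Fin (p + 1)]→L[ℝ] ℝ) (x : Coord n) :
    (wedgeCovector θ a).curryLeft x + wedgeCovector θ (a.curryLeft x) = θ (fun _ => x) • a := by
  have := curryLeft_alternatizeUncurryFin
    (((ContinuousAlternatingMap.ofSubsingleton ℝ (Coord n) ℝ (0 : Fin 1)).symm θ).smulRight a) x
  have h : interior x ∘L (((ContinuousAlternatingMap.ofSubsingleton ℝ (Coord n) ℝ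
      (0 : Fin 1)).symm θ).smulRight a) = ((ContinuousAlternatingMap.ofSubsingleton ℝ (Coord n) ℝ
      (0 : Fin 1)).symm θ).smulRight (a.curryLeft x) := by
    ext v w
    simp [interior_apply]
  rw [h] at this
  simpa [wedgeCovector] using this

theorem curryLeft_wedgeCovector_zero (θ : Coord n [⋀^Fin 1]→L[ℝ] ℝ)
    (a : Coord n [⋀^Fin 0]→L[ℝ] ℝ) (x : Coord n) :
    (wedgeCovector θ a).curryLeft x = θ (fun _ => x) • a := by
  rw [wedgeCovector, curryLeft_alternatizeUncurryFin_zero]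
  simp

/-- Interior multiplication as a bilinear map. -/
def interiorCLM : (Coord n [⋀^Fin (p + 1)]→L[ℝ] ℝ) →L[ℝ] Coord n →L[ℝ]
    (Coord n [⋀^Fin p]→L[ℝ] ℝ) :=
  ContinuousAlternatingMap.curryLeftLI.toContinuousLinearMap

/-- Cartan's formula in coordinates, in positive degree. -/
theorem extDeriv_curryLeft_add {σ : Coord n → Coord n [⋀^Fin (p + 1)]→L[ℝ] ℝ}
    {X : Coord n → Coord n} {y : Coord n} (hσ : DifferentiableAt ℝ σ y)
    (hX : DifferentiableAt ℝ X y) :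
    ⇑(extDeriv (fun z => (σ z).curryLeft (X z)) y + (extDeriv σ y).curryLeft (X y)) =
      fun v => fderiv ℝ σ y (X y) v + act (fderiv ℝ X y) (σ y) v := by
  -- Product rule for ι_X σ: the derivative of σ gives the term that combines with ι_X dσ, and the
  -- derivative of X gives the action of the Jacobian.
  have h1 : HasFDerivAt (fun z => (σ z).curryLeft (X z))
      (interior (X y) ∘L fderiv ℝ σ y + (σ y).curryLeft ∘L fderiv ℝ X y) y := by
    refine ((interiorCLM (n := n) (p := p)).hasFDerivAt_of_bilinear
      hσ.hasFDerivAt hX.hasFDerivAt).congr_fderiv ?_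
    rw [add_comm]
    rfl
  rw [extDeriv, h1.fderiv, ContinuousAlternatingMap.alternatizeUncurryFin_add, extDeriv]
  funext v
  rw [← curryLeft_alternatizeUncurryFin (fderiv ℝ σ y) (X y)]
  simp only [ContinuousAlternatingMap.add_apply, alternatizeUncurryFin_curryLeft_comp]
  ring

/-- Cartan's formula in coordinates, in degree zero. -/
theorem extDeriv_curryLeft_zero (σ : Coord n → Coord n [⋀^Fin 0]→L[ℝ] ℝ) (x y : Coord n) :
    (extDeriv σ y).curryLeft x = fderiv ℝ σ y x := by
  rw [extDeriv, curryLeft_alternatizeUncurryFin_zero]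

/-! ### Derivatives of the determinant and inverse of the metric; lowering the index of ∇X -/

/-- Jacobi's formula: the determinant is multilinear in the rows, and replacing one row is expanded
by Cramer's rule. -/
theorem hasDerivAt_det {A : ℝ → Matrix (Fin n) (Fin n) ℝ} {A' : Matrix (Fin n) (Fin n) ℝ} {t : ℝ}
    (hA : ∀ i j, HasDerivAt (fun s => A s i j) (A' i j) t) :
    HasDerivAt (fun s => (A s).det) (((A t).adjugate * A').trace) t := by
  let f : ContinuousMultilinearMap ℝ (fun _ : Fin n => Fin n → ℝ) ℝ :=
    { (Matrix.detRowAlternating (n := Fin n) (R := ℝ)).toMultilinearMap with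
      cont := (continuous_id (X := Matrix (Fin n) (Fin n) ℝ)).matrix_det }
  have h1 : HasDerivAt (fun s => (fun i => A s i : Fin n → Fin n → ℝ)) (fun i => A' i) t :=
    hasDerivAt_pi.2 fun i => hasDerivAt_pi.2 fun j => hA i j
  have h2 := (f.hasFDerivAt (fun i => A t i)).comp_hasDerivAt t h1
  refine h2.congr_deriv ?_
  rw [ContinuousMultilinearMap.linearDeriv_apply, Matrix.trace_mul_comm]
  simp only [Matrix.trace, Matrix.diag]
  refine Finset.sum_congr rfl fun i _ => ?_
  have h3 : f (Function.update (fun i => A t i) i (A' i)) = ((A t).updateRow i (A' i)).det := rfl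
  rw [h3, ← Matrix.cramer_transpose_apply, Matrix.cramer_eq_adjugate_mulVec, Matrix.mul_apply,
    ← Matrix.adjugate_transpose]
  simp [Matrix.mulVec, dotProduct, mul_comm]

/-- Jacobi's formula gives 2 det A · tr Γ by cyclicity of the trace, and the square root halves the
logarithmic derivative. -/
theorem hasDerivAt_sqrt_det {A : ℝ → Matrix (Fin n) (Fin n) ℝ} {Γ : Matrix (Fin n) (Fin n) ℝ}
    {t : ℝ} (hA : ∀ i j, HasDerivAt (fun s => A s i j) ((Γᵀ * A t + A t * Γ) i j) t)
    (hpos : 0 < (A t).det) :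
    HasDerivAt (fun s => √(A s).det) (√(A t).det * Γ.trace) t := by
  have h := (hasDerivAt_det hA).sqrt hpos.ne'
  refine h.congr_deriv ?_
  have h1 : ((A t).adjugate * (Γᵀ * A t + A t * Γ)).trace = 2 * (A t).det * Γ.trace := by
    rw [Matrix.mul_add, Matrix.trace_add, ← Matrix.mul_assoc, Matrix.trace_mul_comm,
      ← Matrix.mul_assoc, ← Matrix.mul_assoc, Matrix.mul_adjugate, Matrix.adjugate_mul]
    simp
    ring
  rw [h1]
  have := Real.sq_sqrt hpos.le
  have h0 : √(A t).det ≠ 0 := (Real.sqrt_pos.2 hpos).ne'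
  field_simp
  rw [this, mul_comm]

/-- Obtained by differentiating G⁻¹ G = 1. The result has the form that `hasDerivAt_contract`
requires of the inverse metric. -/
theorem hasDerivAt_inv {G : ℝ → Matrix (Fin n) (Fin n) ℝ} {Γ : Matrix (Fin n) (Fin n) ℝ}
    {t : ℝ} (hG : ∀ i j, HasDerivAt (fun s => G s i j) ((Γᵀ * G t + G t * Γ) i j) t)
    (hpos : ∀ᶠ s in nhds t, IsUnit (G s).det)
    (hd : ∀ i j, DifferentiableAt ℝ (fun s => (G s)⁻¹ i j) t) (i j : Fin n) :
    HasDerivAt (fun s => (G s)⁻¹ i j) ((-(Γ * (G t)⁻¹ + (G t)⁻¹ * Γᵀ)) i j) t := by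
  set D : Matrix (Fin n) (Fin n) ℝ := Matrix.of fun i j => deriv (fun s => (G s)⁻¹ i j) t with hD
  have h1 : D * G t + (G t)⁻¹ * (Γᵀ * G t + G t * Γ) = 0 := by
    ext i j
    have h2 : HasDerivAt (fun s => ∑ k, (G s)⁻¹ i k * G s k j)
        (∑ k, (D i k * G t k j + (G t)⁻¹ i k * (Γᵀ * G t + G t * Γ) k j)) t :=
      HasDerivAt.fun_sum fun k _ => (hd i k).hasDerivAt.fun_mul (hG k j)
    have h3 : (fun _ => (1 : Matrix (Fin n) (Fin n) ℝ) i j) =ᶠ[nhds t]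
        fun s => ∑ k, (G s)⁻¹ i k * G s k j := by
      filter_upwards [hpos] with s hs
      rw [← Matrix.nonsing_inv_mul _ hs, Matrix.mul_apply]
    have := (h2.congr_of_eventuallyEq h3).unique (hasDerivAt_const t _)
    rw [Finset.sum_add_distrib] at this
    simpa [Matrix.add_apply, Matrix.mul_apply (M := D), Matrix.mul_apply (M := (G t)⁻¹)] using this
  have h4 : D = -(Γ * (G t)⁻¹ + (G t)⁻¹ * Γᵀ) := by
    have h5 : (D * G t + (G t)⁻¹ * (Γᵀ * G t + G t * Γ)) * (G t)⁻¹ = 0 := by rw [h1, zero_mul]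
    rw [add_mul, Matrix.mul_assoc, Matrix.mul_nonsing_inv _ hpos.self_of_nhds, mul_add, add_mul,
      ← Matrix.mul_assoc, Matrix.mul_assoc _ (G t), Matrix.mul_nonsing_inv _ hpos.self_of_nhds,
      ← Matrix.mul_assoc (G t)⁻¹, Matrix.nonsing_inv_mul _ hpos.self_of_nhds] at h5
    rw [mul_one, mul_one, one_mul] at h5
    rw [eq_neg_iff_add_eq_zero, ← h5]
    abel
  rw [← h4]
  exact (hd i j).hasDerivAt

/-- Here G = (g_ij), dG k = ∂_k g, J is the Jacobian of X and S = ∇X; `hclosed` is ∂_i θ_l = ∂_l θ_i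
for θ_l = g_kl X^k. Lowering the index of S cancels the inverse metric in the Christoffel symbols,
and closedness trades the antisymmetric part ∂_i g_jl - ∂_l g_ij for Jacobian terms, which leaves
half the Lie derivative of g. -/
theorem transpose_mul_eq_of_closed {G : Matrix (Fin n) (Fin n) ℝ} (hG : Gᵀ = G)
    (hdet : IsUnit G.det) (dG : Fin n → Matrix (Fin n) (Fin n) ℝ) (hdG : ∀ k, (dG k)ᵀ = dG k)
    (J : Matrix (Fin n) (Fin n) ℝ) (x : Fin n → ℝ)
    (hclosed : ∀ i l, ∑ k, (dG i k l * x k + G k l * J k i) =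
      ∑ k, (dG l k i * x k + G k i * J k l)) {S : Matrix (Fin n) (Fin n) ℝ}
    (hS : ∀ k i, S k i =
      J k i + ∑ j, (2⁻¹ * ∑ l, G⁻¹ k l * (dG i j l + dG j i l - dG l i j)) * x j) :
    Sᵀ * G = (2⁻¹ : ℝ) • (∑ k, x k • dG k + Jᵀ * G + G * J) := by
  have hinv : ∀ l m, ∑ k, G k l * G⁻¹ k m = if l = m then 1 else 0 := by
    intro l m
    rw [← Matrix.one_apply, ← Matrix.mul_nonsing_inv G hdet, Matrix.mul_apply]
    refine Finset.sum_congr rfl fun k _ => ?_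
    nth_rewrite 1 [← hG]
    rfl
  have hd : ∀ k i j, dG k i j = dG k j i := fun k i j => by
    nth_rewrite 1 [← hdG]; rfl
  ext i l
  have h1 : (Sᵀ * G) i l = ∑ k, G k l * J k i +
      ∑ j, 2⁻¹ * (dG i j l + dG j i l - dG l i j) * x j := by
    simp only [Matrix.mul_apply, Matrix.transpose_apply, hS, add_mul, Finset.sum_add_distrib]
    congr 1
    · exact Finset.sum_congr rfl fun k _ => mul_comm _ _
    · simp only [Finset.sum_mul]
      rw [Finset.sum_comm]
      refine Finset.sum_congr rfl fun j _ => ?_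
      calc _ = 2⁻¹ * (∑ m, (∑ k, G k l * G⁻¹ k m) * (dG i j m + dG j i m - dG m i j)) * x j := by
            simp only [Finset.mul_sum, Finset.sum_mul]
            rw [Finset.sum_comm]
            refine Finset.sum_congr rfl fun k _ => Finset.sum_congr rfl fun m _ => by ring
        _ = _ := by simp [hinv]
  rw [h1]
  have h2 := hclosed i l
  simp only [Finset.sum_add_distrib] at h2
  have h3 : (G * J) i l = ∑ k, G k i * J k l := by
    rw [Matrix.mul_apply]
    refine Finset.sum_congr rfl fun k _ => ?_
    nth_rewrite 1 [← hG]
    rfl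
  have h4 : (Jᵀ * G) i l = ∑ k, G k l * J k i := by
    rw [Matrix.mul_apply]
    exact Finset.sum_congr rfl fun k _ => mul_comm _ _
  have h5 : (∑ k, x k • dG k) i l = ∑ j, dG j i l * x j := by
    simp [Matrix.sum_apply, mul_comm]
  rw [Matrix.smul_apply, Matrix.add_apply, Matrix.add_apply, h3, h4, h5]
  have h6 : ∑ j, 2⁻¹ * (dG i j l + dG j i l - dG l i j) * x j = 2⁻¹ * (∑ j, dG i j l * x j +
      ∑ j, dG j i l * x j - ∑ j, dG l j i * x j) := by
    rw [← Finset.sum_add_distrib, ← Finset.sum_sub_distrib, Finset.mul_sum]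
    refine Finset.sum_congr rfl fun j _ => ?_
    rw [hd l i j]
    ring
  rw [h6, smul_eq_mul]
  linear_combination (2⁻¹ : ℝ) * h2

open MeasureTheory in
-- Integration by parts against the constant function 1.
theorem integral_fderiv_eq_zero {F : Coord n → ℝ} (hF : ContDiff ℝ 1 F)
    (hc : HasCompactSupport F) (v : Coord n) : ∫ y, fderiv ℝ F y v = 0 := by
  obtain ⟨C, hC⟩ := hF.lipschitzWith_of_hasCompactSupport hc one_ne_zero
  have h := (LipschitzWith.const (1 : ℝ)).integral_lineDeriv_mul_eq (μ := volume) hC hc (-v)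
  simp only [neg_neg, mul_one] at h
  have h1 : ∀ y, lineDeriv ℝ F y v = fderiv ℝ F y v := fun y =>
    ((hF.differentiable one_ne_zero) y).lineDeriv_eq_fderiv
  simp only [h1] at h
  rw [← h]
  simp [lineDeriv]

end Algebra

end MorseNovikov

namespace MorseNovikov

/-! ### Charts, transition maps and the metric in coordinates -/

section ChartCalculus

open Matrix Filter Set
open scoped Topology

variable {n : ℕ} {M : Type*} [TopologicalSpace M] [ChartedSpace (EuclideanSpace ℝ (Fin n)) M]

/-- The derivative at `x` of the chart around `x₀`, in the preferred coordinates at `x`. -/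
def toChart (x₀ x : M) : Coord n →L[ℝ] Coord n := chartDeriv x₀ x

/-- The derivative at the image of `x` of the inverse of the chart around `x₀`, in the preferred
coordinates at `x`. -/
def ofChart (x₀ x : M) : Coord n →L[ℝ] Coord n := chartSymmDeriv x₀ (extChartAt (𝓡 n) x₀ x)

/-- The change of coordinates from the chart around `x₀` to the chart around `x₁`. -/
def transition (x₀ x₁ : M) : Coord n → Coord n :=
  extChartAt (𝓡 n) x₁ ∘ (extChartAt (𝓡 n) x₀).symm

/-- The value at `x` of a form, in the preferred coordinates at `x`. -/
def formAt {p : ℕ} (σ : Form n M p) (x : M) : Coord n [⋀^Fin p]→L[ℝ] ℝ := σ x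

theorem formRep_extChartAt {p : ℕ} (σ : Form n M p) {x₀ x : M}
    (hx : x ∈ (extChartAt (𝓡 n) x₀).source) :
    formRep σ x₀ (extChartAt (𝓡 n) x₀ x) =
      (formAt σ x).compContinuousLinearMap (ofChart x₀ x) := by
  -- The form is evaluated at φ⁻¹(φ(x)), whose tangent space is a different type from the one at x;
  -- generalizing the point allows the equality to be substituted.
  have h : ∀ z, z = x → (formAt σ z).compContinuousLinearMap (ofChart x₀ x) =
      (formAt σ x).compContinuousLinearMap (ofChart x₀ x) := by
    rintro z rfl; rfl
  exact h _ ((extChartAt (𝓡 n) x₀).left_inv hx)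

theorem vecRep_extChartAt (X : (x : M) → TangentSpace (𝓡 n) x) {x₀ x : M}
    (hx : x ∈ (extChartAt (𝓡 n) x₀).source) :
    vecRep X x₀ (extChartAt (𝓡 n) x₀ x) = toChart x₀ x (X x) := by
  have h : ∀ z, z = x → toChart x₀ z (X z) = toChart x₀ x (X x) := by
    rintro z rfl; rfl
  exact h _ ((extChartAt (𝓡 n) x₀).left_inv hx)

variable [IsManifold (𝓡 n) ∞ M]

/-- The metric as a bilinear form on `ℝⁿ`. -/
def metricForm (g : Metric n M) (x : M) : Coord n →L[ℝ] Coord n →L[ℝ] ℝ := g.inner x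

theorem metricRep_extChartAt (g : Metric n M) {x₀ x : M}
    (hx : x ∈ (extChartAt (𝓡 n) x₀).source) (i j : Fin n) :
    metricRep g x₀ (extChartAt (𝓡 n) x₀ x) i j =
      metricForm g x (ofChart x₀ x (stdVec i)) (ofChart x₀ x (stdVec j)) := by
  have h : ∀ z, z = x → metricForm g z (ofChart x₀ x (stdVec i)) (ofChart x₀ x (stdVec j)) =
      metricForm g x (ofChart x₀ x (stdVec i)) (ofChart x₀ x (stdVec j)) := by
    rintro z rfl; rfl
  exact h _ ((extChartAt (𝓡 n) x₀).left_inv hx)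

theorem mdifferentiableAt_symm {x₀ : M} {y : Coord n} (hy : y ∈ (extChartAt (𝓡 n) x₀).target) :
    MDifferentiableAt (𝓡 n) (𝓡 n) (extChartAt (𝓡 n) x₀).symm y := by
  have : IsManifold (𝓡 n) 1 M := IsManifold.of_le (n := ∞) (by simp)
  have := mdifferentiableWithinAt_extChartAt_symm (I := 𝓡 n) hy
  exact mdifferentiableWithinAt_univ.1 (by simpa using this)

theorem fderiv_transition {x₀ x₁ x : M} (hx₀ : x ∈ (extChartAt (𝓡 n) x₀).source)
    (hx₁ : x ∈ (extChartAt (𝓡 n) x₁).source) :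
    fderiv ℝ (transition x₀ x₁) (extChartAt (𝓡 n) x₀ x) = toChart x₁ x ∘L ofChart x₀ x := by
  have : IsManifold (𝓡 n) 1 M := IsManifold.of_le (n := ∞) (by simp)
  have hl := (extChartAt (𝓡 n) x₀).left_inv hx₀
  have h1 : MDifferentiableAt (𝓡 n) 𝓘(ℝ, Coord n) (extChartAt (𝓡 n) x₁)
      ((extChartAt (𝓡 n) x₀).symm (extChartAt (𝓡 n) x₀ x)) := by
    rw [hl]
    exact mdifferentiableAt_extChartAt (by simpa using hx₁)
  have h2 := mdifferentiableAt_symm ((extChartAt (𝓡 n) x₀).map_source hx₀)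
  have h3 := mfderiv_comp (extChartAt (𝓡 n) x₀ x) h1 h2
  rw [mfderiv_eq_fderiv] at h3
  have h : ∀ z : M, z = x → (toChart x₁ z : Coord n →L[ℝ] Coord n) ∘L ofChart x₀ x =
      toChart x₁ x ∘L ofChart x₀ x := by
    rintro z rfl; rfl
  exact h3.trans (h _ hl)

/-- The tangent space at x is identified with ℝⁿ by the chart around x itself, so the derivative of
that chart is the identity there. -/
theorem toChart_self (x : M) : toChart x x = ContinuousLinearMap.id ℝ (Coord n) := by
  have : IsManifold (𝓡 n) 1 M := IsManifold.of_le (n := ∞) (by simp)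
  exact mfderiv_extChartAt_self

theorem toChart_comp_ofChart {x₀ x : M} (hx : x ∈ (extChartAt (𝓡 n) x₀).source) :
    toChart x₀ x ∘L ofChart x₀ x = ContinuousLinearMap.id ℝ (Coord n) := by
  rw [← fderiv_transition hx hx]
  have : transition x₀ x₀ =ᶠ[𝓝 (extChartAt (𝓡 n) x₀ x)] id := by
    filter_upwards [(isOpen_extChartAt_target x₀).mem_nhds ((extChartAt (𝓡 n) x₀).map_source hx)]
      with y hy
    exact (extChartAt (𝓡 n) x₀).right_inv hy
  rw [this.fderiv_eq, fderiv_id]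

theorem ofChart_comp_toChart {x₀ x : M} (hx : x ∈ (extChartAt (𝓡 n) x₀).source) :
    ofChart x₀ x ∘L toChart x₀ x = ContinuousLinearMap.id ℝ (Coord n) := by
  have h := congrArg matOf (toChart_comp_ofChart hx)
  rw [matOf_comp, matOf_id] at h
  have h2 := mul_eq_one_comm.1 h
  rw [← matOf_comp, ← matOf_id] at h2
  rw [← ofMat_matOf (_ ∘L _), h2, ofMat_matOf]

theorem ofChart_self (x : M) : ofChart x x = ContinuousLinearMap.id ℝ (Coord n) := by
  have := toChart_comp_ofChart (mem_extChartAt_source (I := 𝓡 n) x)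
  rwa [toChart_self, ContinuousLinearMap.id_comp] at this

theorem isUnit_matOf_ofChart {x₀ x : M} (hx : x ∈ (extChartAt (𝓡 n) x₀).source) :
    IsUnit (matOf (n := n) (ofChart x₀ x)).det := by
  have h := congrArg matOf (toChart_comp_ofChart hx)
  rw [matOf_comp, matOf_id] at h
  exact (Matrix.isUnit_iff_isUnit_det _).1 (IsUnit.of_mul_eq_one_right _ h)

/-- The Gram matrix of the metric at `x` in the preferred coordinates at `x`. -/
def gram (g : Metric n M) (x : M) : Matrix (Fin n) (Fin n) ℝ :=
  Matrix.of fun i j => metricForm g x (stdVec i) (stdVec j)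

theorem metricRep_eq_transpose_mul (g : Metric n M) {x₀ x : M}
    (hx : x ∈ (extChartAt (𝓡 n) x₀).source) :
    metricRep g x₀ (extChartAt (𝓡 n) x₀ x) =
      (matOf (ofChart x₀ x))ᵀ * gram g x * matOf (ofChart x₀ x) := by
  ext i j
  rw [metricRep_extChartAt g hx, map_stdVec, map_stdVec]
  simp [Matrix.mul_apply, gram, Finset.mul_sum, Finset.sum_mul]
  refine Finset.sum_congr rfl fun k _ => Finset.sum_congr rfl fun l _ => by ring

theorem metricRep_self (g : Metric n M) (x : M) :
    metricRep g x (extChartAt (𝓡 n) x x) = gram g x := by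
  rw [metricRep_eq_transpose_mul g (mem_extChartAt_source x), ofChart_self, matOf_id]
  simp

theorem gram_transpose (g : Metric n M) (x : M) : (gram g x)ᵀ = gram g x := by
  ext i j
  exact g.symm x _ _

theorem gram_posDef (g : Metric n M) (x : M) : (gram g x).PosDef := by
  refine Matrix.PosDef.of_dotProduct_mulVec_pos ?_ ?_
  · rw [Matrix.IsHermitian, Matrix.conjTranspose_eq_transpose_of_trivial, gram_transpose]
  · intro v hv
    have h0 : (∑ i, v i • stdVec i : Coord n) ≠ 0 := by
      intro h
      apply hv
      have := sum_smul_stdVec (WithLp.toLp 2 v)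
      simp only [h] at this
      funext i
      simpa using (congrArg (fun w : Coord n => w i) this).symm
    have h1 := g.pos x (∑ i, v i • stdVec i : Coord n) h0
    have h2 : metricForm g x (∑ i, v i • stdVec i) (∑ i, v i • stdVec i) =
        star v ⬝ᵥ (gram g x *ᵥ v) := by
      simp [dotProduct, Matrix.mulVec, gram, Finset.mul_sum]
      rw [Finset.sum_comm]
      refine Finset.sum_congr rfl fun k _ => Finset.sum_congr rfl fun l _ => by ring
    rw [← h2]
    exact h1

theorem metricRep_posDef (g : Metric n M) {x₀ : M} {y : Coord n}
    (hy : y ∈ (extChartAt (𝓡 n) x₀).target) : (metricRep g x₀ y).PosDef := by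
  rw [← (extChartAt (𝓡 n) x₀).right_inv hy]
  have hx := (extChartAt (𝓡 n) x₀).map_target hy
  rw [metricRep_eq_transpose_mul g hx]
  have := (gram_posDef g ((extChartAt (𝓡 n) x₀).symm y)).conjTranspose_mul_mul_same
    (B := matOf (ofChart x₀ ((extChartAt (𝓡 n) x₀).symm y)))
    (Matrix.mulVec_injective_iff_isUnit.2
      ((Matrix.isUnit_iff_isUnit_det _).2 (isUnit_matOf_ofChart hx)))
  rwa [Matrix.conjTranspose_eq_transpose_of_trivial] at this

theorem metricRep_transpose (g : Metric n M) (x₀ : M) (y : Coord n) :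
    (metricRep g x₀ y)ᵀ = metricRep g x₀ y := by
  ext i j
  exact g.symm _ _ _

/-- The coordinate fields are smooth, being the tangent map of φ⁻¹ applied to constant fields, and
the metric is a smooth section of the bundle of bilinear forms; evaluating one on the other stays
smooth. -/
theorem contDiffOn_metricRep (g : Metric n M) (x₀ : M) (i j : Fin n) :
    ContDiffOn ℝ ∞ (fun y => metricRep g x₀ y i j) (extChartAt (𝓡 n) x₀).target := by
  have hU := isOpen_extChartAt_target (I := 𝓡 n) x₀
  have hs := contMDiffOn_extChartAt_symm (I := 𝓡 n) (n := ∞) x₀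
  have hv : ∀ i : Fin n, ContMDiffOn (𝓡 n) ((𝓡 n).prod 𝓘(ℝ, EuclideanSpace ℝ (Fin n))) ∞
      (fun y => (⟨(extChartAt (𝓡 n) x₀).symm y, chartSymmDeriv x₀ y (stdVec i)⟩ :
        Bundle.TotalSpace (EuclideanSpace ℝ (Fin n)) (TangentSpace (𝓡 n) (M := M))))
      (extChartAt (𝓡 n) x₀).target := by
    intro i
    have h1 : ContMDiffOn (𝓡 n) ((𝓡 n).prod 𝓘(ℝ, EuclideanSpace ℝ (Fin n))) ∞
        (fun y => (⟨y, (stdVec i : EuclideanSpace ℝ (Fin n))⟩ :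
          TangentBundle (𝓡 n) (EuclideanSpace ℝ (Fin n))))
        (extChartAt (𝓡 n) x₀).target := by
      intro y hy
      refine (Bundle.contMDiffWithinAt_totalSpace).2 ⟨contMDiffWithinAt_id, ?_⟩
      simpa using! contMDiffWithinAt_const
    have h2 := (hs.contMDiffOn_tangentMapWithin (m := ∞) (by simp) hU.uniqueMDiffOn).comp h1
      (fun y hy => hy)
    refine h2.congr fun y hy => ?_
    simp only [Function.comp_apply, tangentMapWithin]
    rw [mfderivWithin_of_isOpen hU hy]
    rfl
  have hg : ContMDiffOn (𝓡 n)
      ((𝓡 n).prod 𝓘(ℝ, EuclideanSpace ℝ (Fin n) →L[ℝ] EuclideanSpace ℝ (Fin n) →L[ℝ] ℝ)) ∞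
      (fun y => Bundle.TotalSpace.mk'
        (EuclideanSpace ℝ (Fin n) →L[ℝ] EuclideanSpace ℝ (Fin n) →L[ℝ] ℝ)
        (E := fun x : M => TangentSpace (𝓡 n) x →L[ℝ] TangentSpace (𝓡 n) x →L[ℝ] ℝ)
        ((extChartAt (𝓡 n) x₀).symm y)
        (g.inner ((extChartAt (𝓡 n) x₀).symm y))) (extChartAt (𝓡 n) x₀).target :=
    g.contMDiff.comp_contMDiffOn hs
  have h := ContMDiffOn.clm_bundle_apply₂ (F₁ := EuclideanSpace ℝ (Fin n))
    (F₂ := EuclideanSpace ℝ (Fin n)) (F₃ := ℝ)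
    (E₃ := Bundle.Trivial M ℝ) hg (hv i) (hv j)
  rw [← contMDiffOn_iff_contDiffOn]
  intro y hy
  have h2 := (Bundle.contMDiffWithinAt_totalSpace.1 (h y hy)).2
  simpa using! h2

end ChartCalculus

end MorseNovikov

namespace MorseNovikov

/-! ### Smooth forms, exterior derivative and dual vector field in charts -/

section ChartForms

open Matrix Filter Set
open scoped Topology

/-- By Cramer's rule the entries of the inverse are quotients of determinants. -/
theorem contDiffOn_matrix_inv {E : Type*} [NormedAddCommGroup E] [NormedSpace ℝ E] {n : ℕ}
    {G : E → Matrix (Fin n) (Fin n) ℝ} {s : Set E}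
    (hG : ∀ i j, ContDiffOn ℝ ∞ (fun y => G y i j) s) (hdet : ∀ y ∈ s, (G y).det ≠ 0)
    (i j : Fin n) : ContDiffOn ℝ ∞ (fun y => (G y)⁻¹ i j) s := by
  have hd : ∀ {F : E → Matrix (Fin n) (Fin n) ℝ}, (∀ i j, ContDiffOn ℝ ∞ (fun y => F y i j) s) →
      ContDiffOn ℝ ∞ (fun y => (F y).det) s := by
    intro F hF
    simp only [Matrix.det_apply]
    exact ContDiffOn.sum fun σ _ => (contDiffOn_prod fun k _ => hF _ _).const_smul _
  have h : ∀ y, (G y)⁻¹ i j = (G y).det⁻¹ * ((G y).updateRow j (Pi.single i 1)).det := by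
    intro y
    rw [Matrix.inv_def, Matrix.smul_apply, Matrix.adjugate_apply, Ring.inverse_eq_inv, smul_eq_mul]
  simp only [h]
  refine ((hd hG).inv hdet).mul (hd fun k l => ?_)
  by_cases hk : k = j
  · subst hk
    simpa using contDiffOn_const
  · simpa [Matrix.updateRow_ne hk] using hG k l

theorem contDiffOn_matrix_det {E : Type*} [NormedAddCommGroup E] [NormedSpace ℝ E] {n : ℕ}
    {G : E → Matrix (Fin n) (Fin n) ℝ} {s : Set E}
    (hG : ∀ i j, ContDiffOn ℝ ∞ (fun y => G y i j) s) :
    ContDiffOn ℝ ∞ (fun y => (G y).det) s := by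
  simp only [Matrix.det_apply]
  exact ContDiffOn.sum fun σ _ => (contDiffOn_prod fun k _ => hG _ _).const_smul _

variable {n : ℕ} {M : Type*} [TopologicalSpace M] [ChartedSpace (EuclideanSpace ℝ (Fin n)) M]
  {p : ℕ}

/-- Interior multiplication of a form by a vector field. -/
def interiorMul (X : (x : M) → TangentSpace (𝓡 n) x) (σ : Form n M (p + 1)) : Form n M p :=
  fun x => (formAt σ x).curryLeft (X x)

theorem exists_extChartAt_eq {x₀ : M} {y : Coord n} (hy : y ∈ (extChartAt (𝓡 n) x₀).target) :
    ∃ x ∈ (extChartAt (𝓡 n) x₀).source, extChartAt (𝓡 n) x₀ x = y :=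
  ⟨_, (extChartAt (𝓡 n) x₀).map_target hy, (extChartAt (𝓡 n) x₀).right_inv hy⟩

theorem wedgeCovector_comp (a : Coord n [⋀^Fin 1]→L[ℝ] ℝ) (b : Coord n [⋀^Fin p]→L[ℝ] ℝ)
    (L : Coord n →L[ℝ] Coord n) : (wedgeCovector a b).compContinuousLinearMap L =
      wedgeCovector (a.compContinuousLinearMap L) (b.compContinuousLinearMap L) := by
  ext v
  simp only [ContinuousAlternatingMap.compContinuousLinearMap_apply, wedgeCovector_apply]
  rfl

theorem formRep_wedge (θ : Form n M 1) (σ : Form n M p) {x₀ : M}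
    {y : Coord n} (hy : y ∈ (extChartAt (𝓡 n) x₀).target) :
    formRep (wedge θ σ) x₀ y = wedgeCovector (formRep θ x₀ y) (formRep σ x₀ y) := by
  obtain ⟨x, hx, rfl⟩ := exists_extChartAt_eq hy
  rw [formRep_extChartAt _ hx, formRep_extChartAt _ hx, formRep_extChartAt _ hx,
    ← wedgeCovector_comp]
  rfl

theorem transition_extChartAt {x₀ x₁ x : M} (hx₀ : x ∈ (extChartAt (𝓡 n) x₀).source) :
    transition x₀ x₁ (extChartAt (𝓡 n) x₀ x) = extChartAt (𝓡 n) x₁ x := by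
  rw [transition, Function.comp_apply, (extChartAt (𝓡 n) x₀).left_inv hx₀]

theorem eventually_exists_extChartAt_eq {x₀ x₁ x : M} (hx₀ : x ∈ (extChartAt (𝓡 n) x₀).source)
    (hx₁ : x ∈ (extChartAt (𝓡 n) x₁).source) :
    ∀ᶠ y in 𝓝 (extChartAt (𝓡 n) x₀ x), ∃ z ∈ (extChartAt (𝓡 n) x₀).source,
      z ∈ (extChartAt (𝓡 n) x₁).source ∧ extChartAt (𝓡 n) x₀ z = y := by
  have ho : IsOpen ((extChartAt (𝓡 n) x₀).target ∩ (extChartAt (𝓡 n) x₀).symm ⁻¹'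
      (extChartAt (𝓡 n) x₁).source) :=
    (continuousOn_extChartAt_symm x₀).isOpen_inter_preimage (isOpen_extChartAt_target x₀)
      (isOpen_extChartAt_source x₁)
  filter_upwards [ho.mem_nhds ⟨(extChartAt (𝓡 n) x₀).map_source hx₀, by
      rwa [mem_preimage, (extChartAt (𝓡 n) x₀).left_inv hx₀]⟩] with y hy
  exact ⟨_, (extChartAt (𝓡 n) x₀).map_target hy.1, hy.2, (extChartAt (𝓡 n) x₀).right_inv hy.1⟩

theorem IsSmooth.contDiffAt {σ : Form n M p} (hσ : IsSmooth σ) {x₀ : M} {y : Coord n}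
    (hy : y ∈ (extChartAt (𝓡 n) x₀).target) : ContDiffAt ℝ ∞ (formRep σ x₀) y :=
  (hσ x₀).contDiffAt ((isOpen_extChartAt_target x₀).mem_nhds hy)

theorem IsSmooth.add {σ τ : Form n M p} (hσ : IsSmooth σ) (hτ : IsSmooth τ) :
    IsSmooth (fun x => σ x + τ x) := by
  intro x₀
  exact (hσ x₀).add (hτ x₀)

theorem IsSmooth.wedge {θ : Form n M 1} {σ : Form n M p} (hθ : IsSmooth θ) (hσ : IsSmooth σ) :
    IsSmooth (wedge θ σ) := by
  intro x₀
  refine ContDiffOn.congr ?_ fun y hy => formRep_wedge θ σ hy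
  have h1 : ContDiffOn ℝ ∞ (fun y =>
      (ContinuousAlternatingMap.ofSubsingletonLIE (𝕜 := ℝ) (E := Coord n)
      (F := ℝ) (0 : Fin 1)).symm (formRep θ x₀ y)) (extChartAt (𝓡 n) x₀).target :=
    (ContinuousAlternatingMap.ofSubsingletonLIE (𝕜 := ℝ) (E := Coord n)
      (F := ℝ) (0 : Fin 1)).symm.contDiff.comp_contDiffOn (hθ x₀)
  exact (ContinuousAlternatingMap.alternatizeUncurryFinCLM ℝ (Coord n) ℝ).contDiff.comp_contDiffOn
    (h1.smulRight (hσ x₀))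

variable [IsManifold (𝓡 n) ∞ M]

theorem formRep_interiorMul (X : (x : M) → TangentSpace (𝓡 n) x) (σ : Form n M (p + 1)) {x₀ : M}
    {y : Coord n} (hy : y ∈ (extChartAt (𝓡 n) x₀).target) :
    formRep (interiorMul X σ) x₀ y = (formRep σ x₀ y).curryLeft (vecRep X x₀ y) := by
  obtain ⟨x, hx, rfl⟩ := exists_extChartAt_eq hy
  rw [formRep_extChartAt _ hx, formRep_extChartAt _ hx, vecRep_extChartAt _ hx,
    ContinuousAlternatingMap.curryLeft_compContinuousLinearMap]
  have : ofChart x₀ x (toChart x₀ x (X x)) = X x :=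
    congrArg (fun f => f (X x)) (ofChart_comp_toChart hx)
  rw [this]
  rfl

theorem contDiffAt_transition {x₀ x₁ x : M} (hx₀ : x ∈ (extChartAt (𝓡 n) x₀).source)
    (hx₁ : x ∈ (extChartAt (𝓡 n) x₁).source) :
    ContDiffAt ℝ ∞ (transition x₀ x₁) (extChartAt (𝓡 n) x₀ x) := by
  refine (contDiffOn_ext_coord_change (I := 𝓡 n) (n := ∞) x₁ x₀).contDiffAt ?_
  refine IsOpen.mem_nhds ?_ ?_
  · rw [PartialEquiv.trans_source, PartialEquiv.symm_source]
    exact (continuousOn_extChartAt_symm x₀).isOpen_inter_preimage (isOpen_extChartAt_target x₀)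
      (isOpen_extChartAt_source x₁)
  · rw [PartialEquiv.trans_source, PartialEquiv.symm_source]
    exact ⟨(extChartAt (𝓡 n) x₀).map_source hx₀, by
      rwa [mem_preimage, (extChartAt (𝓡 n) x₀).left_inv hx₀]⟩

theorem ofChart_comp_fderiv_transition {x₀ x₁ x : M} (hx₀ : x ∈ (extChartAt (𝓡 n) x₀).source)
    (hx₁ : x ∈ (extChartAt (𝓡 n) x₁).source) :
    ofChart x₁ x ∘L fderiv ℝ (transition x₀ x₁) (extChartAt (𝓡 n) x₀ x) = ofChart x₀ x := by
  rw [fderiv_transition hx₀ hx₁, ← ContinuousLinearMap.comp_assoc, ofChart_comp_toChart hx₁,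
    ContinuousLinearMap.id_comp]

theorem formRep_transition (σ : Form n M p) {x₀ x₁ x : M}
    (hx₀ : x ∈ (extChartAt (𝓡 n) x₀).source) (hx₁ : x ∈ (extChartAt (𝓡 n) x₁).source) :
    formRep σ x₀ (extChartAt (𝓡 n) x₀ x) =
      (formRep σ x₁ (transition x₀ x₁ (extChartAt (𝓡 n) x₀ x))).compContinuousLinearMap
        (fderiv ℝ (transition x₀ x₁) (extChartAt (𝓡 n) x₀ x)) := by
  rw [transition_extChartAt hx₀, formRep_extChartAt _ hx₁, formRep_extChartAt _ hx₀]
  conv_lhs => rw [← ofChart_comp_fderiv_transition hx₀ hx₁]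
  rfl

/-- The exterior derivative at x is defined in the chart around x only. Naturality of d under the
transition map carries it to any other chart containing x. -/
theorem formRep_extDer {σ : Form n M p} (hσ : IsSmooth σ) {x₀ : M} {y : Coord n}
    (hy : y ∈ (extChartAt (𝓡 n) x₀).target) :
    formRep (extDer σ) x₀ y = extDeriv (formRep σ x₀) y := by
  obtain ⟨x, hx, rfl⟩ := exists_extChartAt_eq hy
  have hxx := mem_extChartAt_source (I := 𝓡 n) x
  have h1 : formAt (extDer σ) x = extDeriv (formRep σ x) (extChartAt (𝓡 n) x x) := by
    have : formAt (extDer σ) x = (extDeriv (formRep σ x)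
      (extChartAt (𝓡 n) x x)).compContinuousLinearMap (toChart x x) := rfl
    rw [this, toChart_self]
    rfl
  rw [formRep_extChartAt _ hx, h1]
  have h2 : formRep σ x₀ =ᶠ[𝓝 (extChartAt (𝓡 n) x₀ x)] fun y =>
      (formRep σ x (transition x₀ x y)).compContinuousLinearMap (fderiv ℝ (transition x₀ x) y) := by
    filter_upwards [eventually_exists_extChartAt_eq hx hxx] with y hy
    obtain ⟨z, hz, hz', rfl⟩ := hy
    exact formRep_transition σ hz hz'
  rw [h2.extDeriv_eq, extDeriv_pullback (r := ∞) ?_ (contDiffAt_transition hx hxx)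
      (by rw [minSmoothness_of_isRCLikeNormedField]; exact ENat.LEInfty.out),
    transition_extChartAt hx, fderiv_transition hx hxx, toChart_self,
    ContinuousLinearMap.id_comp]
  rw [transition_extChartAt hx]
  exact (hσ.contDiffAt ((extChartAt (𝓡 n) x).map_source hxx)).differentiableAt (by simp)

theorem IsSmooth.extDer {σ : Form n M p} (hσ : IsSmooth σ) : IsSmooth (extDer σ) := by
  intro x₀
  refine ContDiffOn.congr ?_ fun y hy => formRep_extDer hσ hy
  have h := (hσ x₀).fderiv_of_isOpen (m := ∞) (isOpen_extChartAt_target x₀) (by simp)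
  exact (ContinuousAlternatingMap.alternatizeUncurryFinCLM ℝ (Coord n) ℝ).contDiff.comp_contDiffOn h

theorem IsSmooth.twistedD {θ : Form n M 1} {σ : Form n M p} (hθ : IsSmooth θ) (hσ : IsSmooth σ) :
    IsSmooth (twistedD θ σ) :=
  hσ.extDer.add (hθ.wedge hσ)

theorem isUnit_metricRep_det (g : Metric n M) {x₀ : M} {y : Coord n}
    (hy : y ∈ (extChartAt (𝓡 n) x₀).target) : IsUnit (metricRep g x₀ y).det :=
  (metricRep_posDef g hy).det_pos.ne'.isUnit

theorem contDiffOn_metricRep_inv (g : Metric n M) (x₀ : M) (i j : Fin n) :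
    ContDiffOn ℝ ∞ (fun y => (metricRep g x₀ y)⁻¹ i j) (extChartAt (𝓡 n) x₀).target :=
  contDiffOn_matrix_inv (contDiffOn_metricRep g x₀)
    (fun _ hy => (isUnit_metricRep_det g hy).ne_zero)
    i j

/-- `X` is the vector field dual to `θ`. -/
def IsDual (g : Metric n M) (θ : Form n M 1) (X : (x : M) → TangentSpace (𝓡 n) x) : Prop :=
  ∀ (x : M) (v : TangentSpace (𝓡 n) x), g.inner x (X x) v = θ x (fun _ => v)

variable {g : Metric n M} {θ : Form n M 1} {X : (x : M) → TangentSpace (𝓡 n) x}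

theorem IsDual.formRep_eq (h : IsDual g θ X) {x₀ : M} {y : Coord n}
    (hy : y ∈ (extChartAt (𝓡 n) x₀).target) (j : Fin n) :
    formRep θ x₀ y (fun _ => stdVec j) = ∑ i, metricRep g x₀ y i j * vecRep X x₀ y i := by
  obtain ⟨x, hx, rfl⟩ := exists_extChartAt_eq hy
  simp only [metricRep_extChartAt g hx]
  have h1 : ∑ i, metricForm g x (ofChart x₀ x (stdVec i)) (ofChart x₀ x (stdVec j)) *
      vecRep X x₀ (extChartAt (𝓡 n) x₀ x) i = metricForm g x (ofChart x₀ x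
        (∑ i, vecRep X x₀ (extChartAt (𝓡 n) x₀ x) i • stdVec i)) (ofChart x₀ x (stdVec j)) := by
    simp [mul_comm]
  rw [h1, sum_smul_stdVec, vecRep_extChartAt _ hx, formRep_extChartAt _ hx]
  have : ofChart x₀ x (toChart x₀ x (X x)) = X x :=
    congrArg (fun f => f (X x)) (ofChart_comp_toChart hx)
  rw [this]
  exact (h x (ofChart x₀ x (stdVec j))).symm

/-- Solving the linear system g_ij X^i = θ_j; smoothness of X follows from that of θ and g. -/
theorem IsDual.vecRep_eq (h : IsDual g θ X) {x₀ : M} {y : Coord n}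
    (hy : y ∈ (extChartAt (𝓡 n) x₀).target) :
    vecRep X x₀ y = sharp (metricRep g x₀ y)⁻¹ (formRep θ x₀ y) := by
  ext j
  simp only [sharp, h.formRep_eq hy, Finset.mul_sum]
  rw [Finset.sum_comm]
  have h1 : ∀ k, ∑ i, (metricRep g x₀ y)⁻¹ i j * (metricRep g x₀ y k i * vecRep X x₀ y k) =
      (metricRep g x₀ y * (metricRep g x₀ y)⁻¹) k j * vecRep X x₀ y k := by
    intro k
    rw [Matrix.mul_apply, Finset.sum_mul]
    exact Finset.sum_congr rfl fun i _ => by ring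
  simp only [h1, Matrix.mul_nonsing_inv _ (isUnit_metricRep_det g hy), Matrix.one_apply]
  simp

theorem IsDual.contDiffOn (h : IsDual g θ X) (hθ : IsSmooth θ) (x₀ : M) :
    ContDiffOn ℝ ∞ (vecRep X x₀) (extChartAt (𝓡 n) x₀).target := by
  refine ContDiffOn.congr ?_ fun y hy => h.vecRep_eq hy
  rw [contDiffOn_euclidean]
  intro j
  simp only [sharp]
  refine ContDiffOn.sum fun i _ => (contDiffOn_metricRep_inv g x₀ i j).mul ?_
  exact (ContinuousAlternatingMap.apply ℝ (Coord n) ℝ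
    (fun _ : Fin 1 => stdVec i)).contDiff.comp_contDiffOn (hθ x₀)

theorem IsDual.isSmooth_interiorMul (h : IsDual g θ X) (hθ : IsSmooth θ) {σ : Form n M (p + 1)}
    (hσ : IsSmooth σ) : IsSmooth (interiorMul X σ) := by
  intro x₀
  refine ContDiffOn.congr ?_ fun y hy => formRep_interiorMul X σ hy
  have h0 : IsBoundedLinearMap ℝ (fun a : Coord n [⋀^Fin (p + 1)]→L[ℝ] ℝ => a.curryLeft) :=
    ⟨⟨fun _ _ => rfl, fun _ _ => rfl⟩, 1, one_pos, fun a => by simp⟩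
  have h0' : ContDiff ℝ ∞ (fun a : Coord n [⋀^Fin (p + 1)]→L[ℝ] ℝ => a.curryLeft) := h0.contDiff
  have h1 : ContDiffOn ℝ ∞ (fun y => (formRep σ x₀ y).curryLeft) (extChartAt (𝓡 n) x₀).target :=
    h0'.comp_contDiffOn (hσ x₀)
  exact h1.clm_apply (h.contDiffOn hθ x₀)

end ChartForms

end MorseNovikov

namespace MorseNovikov

/-! ### The Lie derivative of the metric and the tensoriality of ∇X -/

section Covariant

open Matrix Filter Set
open scoped Topology

variable {n : ℕ}

theorem hasDerivAt_matrix_mul {A B : ℝ → Matrix (Fin n) (Fin n) ℝ}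
    {A' B' : Matrix (Fin n) (Fin n) ℝ} {t : ℝ}
    (hA : ∀ i j, HasDerivAt (fun s => A s i j) (A' i j) t)
    (hB : ∀ i j, HasDerivAt (fun s => B s i j) (B' i j) t) (i j : Fin n) :
    HasDerivAt (fun s => (A s * B s) i j) ((A' * B t + A t * B') i j) t := by
  simp only [Matrix.mul_apply, Matrix.add_apply, ← Finset.sum_add_distrib]
  exact HasDerivAt.fun_sum fun k _ => (hA i k).fun_mul (hB k j)

theorem hasDerivAt_line (y v : Coord n) : HasDerivAt (fun t : ℝ => y + t • v) v 0 := by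
  simpa using ((hasDerivAt_id (0 : ℝ)).smul_const v).const_add y

theorem hasDerivAt_comp_line {F : Type*} [NormedAddCommGroup F] [NormedSpace ℝ F] {f : Coord n → F}
    {y : Coord n} (hf : DifferentiableAt ℝ f y) (v : Coord n) :
    HasDerivAt (fun t : ℝ => f (y + t • v)) (fderiv ℝ f y v) 0 := by
  have h : HasFDerivAt f (fderiv ℝ f y) (y + (0 : ℝ) • v) := by simpa using hf.hasFDerivAt
  exact h.comp_hasDerivAt 0 (hasDerivAt_line y v)

theorem tendsto_line (y v : Coord n) : Tendsto (fun t : ℝ => y + t • v) (𝓝 0) (𝓝 y) := by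
  have := (hasDerivAt_line y v).continuousAt.tendsto
  simpa using this

/-- The entry functional of `matOf` as a continuous linear map. -/
def matEntry (i j : Fin n) : (Coord n →L[ℝ] Coord n) →L[ℝ] ℝ :=
  (EuclideanSpace.proj i : Coord n →L[ℝ] ℝ) ∘L ContinuousLinearMap.apply ℝ (Coord n) (stdVec j)

theorem hsSq_conj {G S P : Matrix (Fin n) (Fin n) ℝ} (hP : IsUnit P.det) :
    hsSq (Pᵀ * G * P) (P⁻¹ * S * P) = hsSq G S := by
  rw [hsSq_eq_trace, hsSq_eq_trace]
  have h1 : P * P⁻¹ = 1 := Matrix.mul_nonsing_inv P hP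
  have h2 : P⁻¹ᵀ * Pᵀ = 1 := by rw [← Matrix.transpose_mul, h1, Matrix.transpose_one]
  simp only [Matrix.mul_inv_rev, Matrix.transpose_mul, Matrix.transpose_transpose,
    Matrix.mul_assoc]
  rw [Matrix.trace_mul_comm]
  simp only [Matrix.mul_assoc]
  rw [← Matrix.mul_assoc P⁻¹ᵀ Pᵀ, h2, Matrix.one_mul]
  rw [← Matrix.mul_assoc Pᵀ⁻¹, Matrix.nonsing_inv_mul _ (by rwa [Matrix.det_transpose]),
    Matrix.one_mul, h1, Matrix.mul_one, ← Matrix.mul_assoc P, h1, Matrix.one_mul]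

variable {M : Type*} [TopologicalSpace M] [ChartedSpace (EuclideanSpace ℝ (Fin n)) M]
  {p : ℕ} [IsManifold (𝓡 n) ∞ M]

/-- The derivative of the matrix of the metric in a chart. -/
def dirMat (g : Metric n M) (x₀ : M) (y v : Coord n) : Matrix (Fin n) (Fin n) ℝ :=
  Matrix.of fun i j => fderiv ℝ (fun z => metricRep g x₀ z i j) y v

/-- The Lie derivative of the metric along `X` in a chart. -/
def lieMat (g : Metric n M) (X : (x : M) → TangentSpace (𝓡 n) x) (x₀ : M) (y : Coord n) :
    Matrix (Fin n) (Fin n) ℝ :=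
  dirMat g x₀ y (vecRep X x₀ y) + (matOf (fderiv ℝ (vecRep X x₀) y))ᵀ * metricRep g x₀ y +
    metricRep g x₀ y * matOf (fderiv ℝ (vecRep X x₀) y)

/-- The components of `∇X` in a chart. -/
def covMat (g : Metric n M) (X : (x : M) → TangentSpace (𝓡 n) x) (x₀ : M) (y : Coord n) :
    Matrix (Fin n) (Fin n) ℝ :=
  Matrix.of fun k i => fderiv ℝ (fun z => vecRep X x₀ z k) y (stdVec i) +
    ∑ j, christoffel g x₀ y k i j * vecRep X x₀ y j

variable {g : Metric n M} {θ : Form n M 1} {X : (x : M) → TangentSpace (𝓡 n) x}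

theorem differentiableAt_metricRep (g : Metric n M) {x₀ : M} {y : Coord n}
    (hy : y ∈ (extChartAt (𝓡 n) x₀).target) (i j : Fin n) :
    DifferentiableAt ℝ (fun z => metricRep g x₀ z i j) y :=
  ((contDiffOn_metricRep g x₀ i j).contDiffAt
    ((isOpen_extChartAt_target x₀).mem_nhds hy)).differentiableAt (by simp)

theorem hasDerivAt_metricRep_line (g : Metric n M) {x₀ : M} {y : Coord n}
    (hy : y ∈ (extChartAt (𝓡 n) x₀).target) (v : Coord n) (i j : Fin n) :
    HasDerivAt (fun t : ℝ => metricRep g x₀ (y + t • v) i j) (dirMat g x₀ y v i j) 0 :=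
  hasDerivAt_comp_line (differentiableAt_metricRep g hy i j) v

theorem vecRep_transition (X : (x : M) → TangentSpace (𝓡 n) x) {x₀ x₁ x : M}
    (hx₀ : x ∈ (extChartAt (𝓡 n) x₀).source) (hx₁ : x ∈ (extChartAt (𝓡 n) x₁).source) :
    vecRep X x₁ (transition x₀ x₁ (extChartAt (𝓡 n) x₀ x)) =
      fderiv ℝ (transition x₀ x₁) (extChartAt (𝓡 n) x₀ x)
        (vecRep X x₀ (extChartAt (𝓡 n) x₀ x)) := by
  rw [transition_extChartAt hx₀, vecRep_extChartAt _ hx₁, vecRep_extChartAt _ hx₀,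
    fderiv_transition hx₀ hx₁]
  have : ofChart x₀ x (toChart x₀ x (X x)) = X x :=
    congrArg (fun f => f (X x)) (ofChart_comp_toChart hx₀)
  exact (congrArg (toChart x₁ x) this).symm

theorem metricRep_transition (g : Metric n M) {x₀ x₁ x : M}
    (hx₀ : x ∈ (extChartAt (𝓡 n) x₀).source) (hx₁ : x ∈ (extChartAt (𝓡 n) x₁).source) :
    metricRep g x₀ (extChartAt (𝓡 n) x₀ x) =
      (matOf (fderiv ℝ (transition x₀ x₁) (extChartAt (𝓡 n) x₀ x)))ᵀ *
        metricRep g x₁ (transition x₀ x₁ (extChartAt (𝓡 n) x₀ x)) *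
        matOf (fderiv ℝ (transition x₀ x₁) (extChartAt (𝓡 n) x₀ x)) := by
  rw [transition_extChartAt hx₀, metricRep_eq_transpose_mul g hx₀,
    metricRep_eq_transpose_mul g hx₁, ← ofChart_comp_fderiv_transition hx₀ hx₁, matOf_comp,
    Matrix.transpose_mul]
  simp only [Matrix.mul_assoc]

/-- With P the Jacobian of the transition map Φ and Q the derivative of P along X, differentiating
G₀ = Pᵀ (G₁ ∘ Φ) P along X and differentiating X₁ ∘ Φ = P X₀ both produce terms in Q, and these
cancel in the Lie derivative. -/
theorem lieMat_transition (g : Metric n M)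
    (hX : ∀ x₀ : M, ContDiffOn ℝ ∞ (vecRep X x₀) (extChartAt (𝓡 n) x₀).target) {x₀ x₁ x : M}
    (hx₀ : x ∈ (extChartAt (𝓡 n) x₀).source) (hx₁ : x ∈ (extChartAt (𝓡 n) x₁).source) :
    lieMat g X x₀ (extChartAt (𝓡 n) x₀ x) =
      (matOf (fderiv ℝ (transition x₀ x₁) (extChartAt (𝓡 n) x₀ x)))ᵀ *
        lieMat g X x₁ (extChartAt (𝓡 n) x₁ x) *
        matOf (fderiv ℝ (transition x₀ x₁) (extChartAt (𝓡 n) x₀ x)) := by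
  set Φ : Coord n → Coord n := transition x₀ x₁ with hΦ
  set y := extChartAt (𝓡 n) x₀ x with hy
  set v := vecRep X x₀ y with hv
  set P := matOf (fderiv ℝ Φ y) with hP
  set Q := matOf (fderiv ℝ (fderiv ℝ Φ) y v) with hQ
  have hΦy : extChartAt (𝓡 n) x₁ x = Φ y := (transition_extChartAt hx₀).symm
  rw [hΦy]
  have hyt : y ∈ (extChartAt (𝓡 n) x₀).target := (extChartAt (𝓡 n) x₀).map_source hx₀
  have hΦt : Φ y ∈ (extChartAt (𝓡 n) x₁).target := hΦy ▸ (extChartAt (𝓡 n) x₁).map_source hx₁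
  have hc : ContDiffAt ℝ ∞ Φ y := contDiffAt_transition hx₀ hx₁
  have hd : DifferentiableAt ℝ Φ y := hc.differentiableAt (by simp)
  have hd2 : DifferentiableAt ℝ (fderiv ℝ Φ) y :=
    (hc.fderiv_right (m := ∞) (by simp)).differentiableAt (by simp)
  have hev := eventually_exists_extChartAt_eq hx₀ hx₁
  have hG := metricRep_transition g hx₀ hx₁
  have hv1 : vecRep X x₁ (Φ y) = fderiv ℝ Φ y v := vecRep_transition X hx₀ hx₁
  have hPd : ∀ i j, HasDerivAt (fun t : ℝ => matOf (fderiv ℝ Φ (y + t • v)) i j) (Q i j) 0 := by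
    intro i j
    exact (matEntry i j).hasFDerivAt.comp_hasDerivAt 0 (hasDerivAt_comp_line hd2 v)
  have hGd : ∀ i j, HasDerivAt (fun t : ℝ => metricRep g x₁ (Φ (y + t • v)) i j)
      (dirMat g x₁ (Φ y) (vecRep X x₁ (Φ y)) i j) 0 := by
    intro i j
    have h1 := (differentiableAt_metricRep g hΦt i j).hasFDerivAt.comp y hd.hasFDerivAt
    have h2 := hasDerivAt_comp_line h1.differentiableAt v
    rw [h1.fderiv] at h2
    rw [hv1]
    exact h2
  have hD : dirMat g x₀ y v = (Qᵀ * metricRep g x₁ (Φ y) +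
      Pᵀ * dirMat g x₁ (Φ y) (vecRep X x₁ (Φ y))) * P + Pᵀ * metricRep g x₁ (Φ y) * Q := by
    ext i j
    refine (hasDerivAt_metricRep_line g hyt v i j).unique ?_
    have h1 := hasDerivAt_matrix_mul (hasDerivAt_matrix_mul
      (A := fun t : ℝ => (matOf (fderiv ℝ Φ (y + t • v)))ᵀ) (A' := Qᵀ) (fun i j => hPd j i) hGd)
        hPd i j
    simp only [zero_smul, add_zero] at h1
    refine h1.congr_of_eventuallyEq ?_
    filter_upwards [(tendsto_line y v).eventually hev] with t ht
    obtain ⟨z, hz, hz', hzt⟩ := ht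
    rw [← hzt, metricRep_transition g hz hz']
  have hXd : ∀ x₂ : M, ∀ {w : Coord n}, w ∈ (extChartAt (𝓡 n) x₂).target →
      DifferentiableAt ℝ (vecRep X x₂) w := fun x₂ w hw =>
    ((hX x₂).contDiffAt ((isOpen_extChartAt_target x₂).mem_nhds hw)).differentiableAt (by simp)
  have hJ : matOf (fderiv ℝ (vecRep X x₁) (Φ y)) * P =
      Q + P * matOf (fderiv ℝ (vecRep X x₀) y) := by
    have h1 := (hXd x₁ hΦt).hasFDerivAt.comp y hd.hasFDerivAt
    have h2 := hd2.hasFDerivAt.clm_apply (hXd x₀ hyt).hasFDerivAt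
    have h3 : vecRep X x₁ ∘ Φ =ᶠ[𝓝 y] fun z => fderiv ℝ Φ z (vecRep X x₀ z) := by
      filter_upwards [hev] with w hw
      obtain ⟨z, hz, hz', rfl⟩ := hw
      exact vecRep_transition X hz hz'
    have h4 := h1.unique (h2.congr_of_eventuallyEq h3)
    -- Symmetry of the second derivative of Φ: the term from differentiating P in P X₀ is the same Q
    -- as in the derivative of the metric.
    have h5 : (fderiv ℝ (fderiv ℝ Φ) y).flip (vecRep X x₀ y) = fderiv ℝ (fderiv ℝ Φ) y v := by
      ext1 w
      exact (hc.isSymmSndFDerivAt (by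
        rw [minSmoothness_of_isRCLikeNormedField]; exact ENat.LEInfty.out)) w v
    rw [h5] at h4
    rw [hP, ← matOf_comp, h4, matOf_add, matOf_comp, add_comm]
  have hJt : Pᵀ * (matOf (fderiv ℝ (vecRep X x₁) (Φ y)))ᵀ =
      Qᵀ + (matOf (fderiv ℝ (vecRep X x₀) y))ᵀ * Pᵀ := by
    rw [← Matrix.transpose_mul, hJ, Matrix.transpose_add, Matrix.transpose_mul]
  rw [lieMat, lieMat, hD, hG]
  have e1 : Pᵀ * (dirMat g x₁ (Φ y) (vecRep X x₁ (Φ y)) +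
      (matOf (fderiv ℝ (vecRep X x₁) (Φ y)))ᵀ * metricRep g x₁ (Φ y) +
        metricRep g x₁ (Φ y) * matOf (fderiv ℝ (vecRep X x₁) (Φ y))) * P =
      Pᵀ * dirMat g x₁ (Φ y) (vecRep X x₁ (Φ y)) * P +
        (Pᵀ * (matOf (fderiv ℝ (vecRep X x₁) (Φ y)))ᵀ) * metricRep g x₁ (Φ y) * P +
        Pᵀ * metricRep g x₁ (Φ y) * (matOf (fderiv ℝ (vecRep X x₁) (Φ y)) * P) := by
    noncomm_ring
  rw [e1, hJ, hJt]
  noncomm_ring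

/-- The closedness of `θ`, in a chart. -/
theorem fderiv_formRep_symm (hθ : IsSmooth θ) (hcl : ∀ x, extDer θ x = 0) {x₀ : M} {y : Coord n}
    (hy : y ∈ (extChartAt (𝓡 n) x₀).target) (i l : Fin n) :
    fderiv ℝ (fun z => formRep θ x₀ z (fun _ => stdVec l)) y (stdVec i) =
      fderiv ℝ (fun z => formRep θ x₀ z (fun _ => stdVec i)) y (stdVec l) := by
  have h1 : extDeriv (formRep θ x₀) y = 0 := by
    rw [← formRep_extDer hθ hy, formRep, hcl]
    ext v
    rfl
  have h2 := extDeriv_apply ((hθ.contDiffAt hy).differentiableAt (by simp)) ![stdVec i, stdVec l]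
  rw [h1, Fin.sum_univ_two] at h2
  have h3 : (0 : Fin 2).removeNth ![stdVec (n := n) i, stdVec l] = fun _ => stdVec l := by
    funext k; fin_cases k; rfl
  have h4 : (1 : Fin 2).removeNth ![stdVec (n := n) i, stdVec l] = fun _ => stdVec i := by
    funext k; fin_cases k; rfl
  rw [h3, h4] at h2
  simp at h2
  linarith

/-- Closedness of θ makes ∇X symmetric with respect to g, and the symmetric part of the lowered ∇X
is always half the Lie derivative of g. -/
theorem transpose_covMat_mul (h : IsDual g θ X) (hθ : IsSmooth θ) (hcl : ∀ x, extDer θ x = 0)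
    {x₀ : M} {y : Coord n} (hy : y ∈ (extChartAt (𝓡 n) x₀).target) :
    (covMat g X x₀ y)ᵀ * metricRep g x₀ y = (2⁻¹ : ℝ) • lieMat g X x₀ y := by
  have hXd : DifferentiableAt ℝ (vecRep X x₀) y := ((h.contDiffOn hθ x₀).contDiffAt
    ((isOpen_extChartAt_target x₀).mem_nhds hy)).differentiableAt (by simp)
  have hXk : ∀ k, HasFDerivAt (fun z => vecRep X x₀ z k)
      ((EuclideanSpace.proj k : Coord n →L[ℝ] ℝ) ∘L fderiv ℝ (vecRep X x₀) y) y := fun k =>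
    (EuclideanSpace.proj k : Coord n →L[ℝ] ℝ).hasFDerivAt.comp y hXd.hasFDerivAt
  have hJ : ∀ k i, fderiv ℝ (fun z => vecRep X x₀ z k) y (stdVec i) =
      matOf (fderiv ℝ (vecRep X x₀) y) k i := by
    intro k i
    rw [(hXk k).fderiv]
    rfl
  have hcov : ∀ k i, covMat g X x₀ y k i = matOf (fderiv ℝ (vecRep X x₀) y) k i +
      ∑ j, (2⁻¹ * ∑ l, (metricRep g x₀ y)⁻¹ k l *
        (dirMat g x₀ y (stdVec i) j l + dirMat g x₀ y (stdVec j) i l -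
          dirMat g x₀ y (stdVec l) i j)) * vecRep X x₀ y j := by
    intro k i
    rw [← hJ]
    rfl
  have hdir : dirMat g x₀ y (vecRep X x₀ y) =
      ∑ k, vecRep X x₀ y k • dirMat g x₀ y (stdVec k) := by
    ext i j
    conv_lhs => rw [← sum_smul_stdVec (vecRep X x₀ y)]
    simp [dirMat, Matrix.sum_apply]
  rw [transpose_mul_eq_of_closed (metricRep_transpose g x₀ y) (isUnit_metricRep_det g hy)
    (fun k => dirMat g x₀ y (stdVec k)) ?_ (matOf (fderiv ℝ (vecRep X x₀) y))
    (fun k => vecRep X x₀ y k) ?_ hcov, lieMat, hdir]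
  · intro k
    ext i j
    simp only [dirMat, Matrix.transpose_apply, Matrix.of_apply]
    congr 2
    funext z
    exact congrFun (congrFun (metricRep_transpose g x₀ z) i) j
  · have h1 : ∀ i l, fderiv ℝ (fun z => formRep θ x₀ z (fun _ => stdVec l)) y (stdVec i) =
        ∑ k, (dirMat g x₀ y (stdVec i) k l * vecRep X x₀ y k +
          metricRep g x₀ y k l * matOf (fderiv ℝ (vecRep X x₀) y) k i) := by
      intro i l
      have h2 : (fun z => formRep θ x₀ z (fun _ => stdVec l)) =ᶠ[𝓝 y]
          fun z => ∑ k, metricRep g x₀ z k l * vecRep X x₀ z k := by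
        filter_upwards [(isOpen_extChartAt_target x₀).mem_nhds hy] with z hz
        exact h.formRep_eq hz l
      rw [h2.fderiv_eq]
      have h3 := HasFDerivAt.fun_sum (u := Finset.univ) fun k _ =>
        (differentiableAt_metricRep g hy k l).hasFDerivAt.fun_mul (hXk k)
      rw [h3.fderiv]
      simp only [_root_.sum_apply]
      refine Finset.sum_congr rfl fun k _ => ?_
      simp [dirMat, matOf]
      ring
    intro i l
    rw [← h1, ← h1]
    exact fderiv_formRep_symm hθ hcl hy i l

/-- By symmetry of the lowered ∇X, the Lie derivative of g equals SᵀG + GS with S = ∇X; subtracting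
the Jacobian terms isolates the derivative of g. The difference S - J is the matrix of the
connection along X, so this is compatibility with the metric. -/
theorem dirMat_eq (h : IsDual g θ X) (hθ : IsSmooth θ) (hcl : ∀ x, extDer θ x = 0)
    {x₀ : M} {y : Coord n} (hy : y ∈ (extChartAt (𝓡 n) x₀).target) :
    dirMat g x₀ y (vecRep X x₀ y) =
      (covMat g X x₀ y - matOf (fderiv ℝ (vecRep X x₀) y))ᵀ * metricRep g x₀ y +
        metricRep g x₀ y * (covMat g X x₀ y - matOf (fderiv ℝ (vecRep X x₀) y)) := by
  have h1 := transpose_covMat_mul h hθ hcl hy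
  have h2 := congrArg Matrix.transpose h1
  have h3 : (lieMat g X x₀ y)ᵀ = lieMat g X x₀ y := by
    have h4 : (dirMat g x₀ y (vecRep X x₀ y))ᵀ = dirMat g x₀ y (vecRep X x₀ y) := by
      ext i j
      simp only [dirMat, Matrix.transpose_apply, Matrix.of_apply]
      congr 2
      funext z
      exact congrFun (congrFun (metricRep_transpose g x₀ z) i) j
    simp only [lieMat, Matrix.transpose_add, Matrix.transpose_mul, Matrix.transpose_transpose,
      metricRep_transpose, h4]
    abel
  rw [Matrix.transpose_mul, Matrix.transpose_smul, Matrix.transpose_transpose,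
    metricRep_transpose, h3] at h2
  have h5 : lieMat g X x₀ y = (covMat g X x₀ y)ᵀ * metricRep g x₀ y +
      metricRep g x₀ y * covMat g X x₀ y := by
    rw [h1, h2, ← add_smul]
    norm_num
  rw [Matrix.transpose_sub, Matrix.sub_mul, Matrix.mul_sub]
  rw [lieMat] at h5
  rw [sub_add_sub_comm, ← h5]
  abel

/-- Both g and its Lie derivative along X are tensorial, and g is invertible, so ∇X, which is half
their quotient, is tensorial too. -/
theorem covMat_transition (h : IsDual g θ X) (hθ : IsSmooth θ) (hcl : ∀ x, extDer θ x = 0)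
    {x₀ x₁ x : M} (hx₀ : x ∈ (extChartAt (𝓡 n) x₀).source)
    (hx₁ : x ∈ (extChartAt (𝓡 n) x₁).source) :
    matOf (fderiv ℝ (transition x₀ x₁) (extChartAt (𝓡 n) x₀ x)) *
        covMat g X x₀ (extChartAt (𝓡 n) x₀ x) = covMat g X x₁ (extChartAt (𝓡 n) x₁ x) *
      matOf (fderiv ℝ (transition x₀ x₁) (extChartAt (𝓡 n) x₀ x)) := by
  set P := matOf (fderiv ℝ (transition x₀ x₁) (extChartAt (𝓡 n) x₀ x))
  have h0 := transpose_covMat_mul h hθ hcl ((extChartAt (𝓡 n) x₀).map_source hx₀)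
  have h1 := transpose_covMat_mul h hθ hcl ((extChartAt (𝓡 n) x₁).map_source hx₁)
  have hL : lieMat g X x₀ _ = Pᵀ * lieMat g X x₁ _ * P :=
    lieMat_transition g (h.contDiffOn hθ) hx₀ hx₁
  have hG : metricRep g x₀ _ = Pᵀ * metricRep g x₁ _ * P := metricRep_transition g hx₀ hx₁
  rw [transition_extChartAt hx₀] at hG
  have hu := isUnit_metricRep_det g ((extChartAt (𝓡 n) x₀).map_source hx₀)
  have huP : IsUnit P.det := by
    rw [hG, Matrix.det_mul] at hu
    exact isUnit_of_mul_isUnit_right hu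
  have hu1 := isUnit_metricRep_det g ((extChartAt (𝓡 n) x₁).map_source hx₁)
  rw [hL, hG, ← Matrix.smul_mul, ← Matrix.mul_smul, ← h1] at h0
  have h2 : (P * covMat g X x₀ (extChartAt (𝓡 n) x₀ x))ᵀ *
      (metricRep g x₁ (extChartAt (𝓡 n) x₁ x) * P) =
      (covMat g X x₁ (extChartAt (𝓡 n) x₁ x) * P)ᵀ *
      (metricRep g x₁ (extChartAt (𝓡 n) x₁ x) * P) := by
    rw [Matrix.transpose_mul, Matrix.transpose_mul]
    simpa only [Matrix.mul_assoc] using h0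
  have h3 : IsUnit (metricRep g x₁ (extChartAt (𝓡 n) x₁ x) * P).det := by
    rw [Matrix.det_mul]
    exact hu1.mul huP
  have h4 := congrArg (· * (metricRep g x₁ (extChartAt (𝓡 n) x₁ x) * P)⁻¹) h2
  simp only [Matrix.mul_assoc _ (metricRep g x₁ (extChartAt (𝓡 n) x₁ x) * P),
    Matrix.mul_nonsing_inv _ h3, Matrix.mul_one] at h4
  exact Matrix.transpose_injective h4

theorem covMat_conj (h : IsDual g θ X) (hθ : IsSmooth θ) (hcl : ∀ x, extDer θ x = 0)
    {x₀ x : M} (hx₀ : x ∈ (extChartAt (𝓡 n) x₀).source) :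
    covMat g X x₀ (extChartAt (𝓡 n) x₀ x) = (matOf (ofChart x₀ x))⁻¹ *
      covMat g X x (extChartAt (𝓡 n) x x) * matOf (ofChart x₀ x) := by
  have h1 := covMat_transition h hθ hcl hx₀ (mem_extChartAt_source (I := 𝓡 n) x)
  rw [fderiv_transition hx₀ (mem_extChartAt_source (I := 𝓡 n) x), toChart_self,
    ContinuousLinearMap.id_comp] at h1
  rw [Matrix.mul_assoc, ← h1, ← Matrix.mul_assoc,
    Matrix.nonsing_inv_mul _ (isUnit_matOf_ofChart hx₀), Matrix.one_mul]

theorem divergence_eq_trace (h : IsDual g θ X) (hθ : IsSmooth θ) (hcl : ∀ x, extDer θ x = 0)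
    {x₀ x : M} (hx₀ : x ∈ (extChartAt (𝓡 n) x₀).source) :
    divergence g X x = (covMat g X x₀ (extChartAt (𝓡 n) x₀ x)).trace := by
  rw [covMat_conj h hθ hcl hx₀, Matrix.trace_mul_comm, ← Matrix.mul_assoc,
    Matrix.mul_nonsing_inv _ (isUnit_matOf_ofChart hx₀), Matrix.one_mul]
  rfl

theorem gradNorm_eq_sqrt_hsSq (h : IsDual g θ X) (hθ : IsSmooth θ) (hcl : ∀ x, extDer θ x = 0)
    {x₀ x : M} (hx₀ : x ∈ (extChartAt (𝓡 n) x₀).source) :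
    gradNorm g X x = √(hsSq (metricRep g x₀ (extChartAt (𝓡 n) x₀ x))
      (covMat g X x₀ (extChartAt (𝓡 n) x₀ x))) := by
  rw [covMat_conj h hθ hcl hx₀, metricRep_eq_transpose_mul g hx₀, ← metricRep_self,
    hsSq_conj (isUnit_matOf_ofChart hx₀)]
  rfl

end Covariant

end MorseNovikov

namespace MorseNovikov

/-! ### Pointwise identities and estimates for forms on M -/

section Pointwise

open Matrix Filter Set
open scoped Topology

variable {n p : ℕ} {M : Type*} [TopologicalSpace M] [ChartedSpace (EuclideanSpace ℝ (Fin n)) M]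

/-- A function on `M` that is smooth in the charts. -/
def IsSmoothFun (f : M → ℝ) : Prop :=
  ∀ x₀ : M, ContDiffOn ℝ ∞ (f ∘ (extChartAt (𝓡 n) x₀).symm) (extChartAt (𝓡 n) x₀).target

/-- The derivative of a function along a vector field. -/
def dirDeriv (X : (x : M) → TangentSpace (𝓡 n) x) (f : M → ℝ) (x : M) : ℝ :=
  fderiv ℝ (f ∘ (extChartAt (𝓡 n) x).symm) (extChartAt (𝓡 n) x x) (X x)

theorem continuous_of_charts {f : M → ℝ}
    (h : ∀ x₀ : M, ∃ F : Coord n → ℝ, ContinuousOn F (extChartAt (𝓡 n) x₀).target ∧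
      ∀ x ∈ (extChartAt (𝓡 n) x₀).source, f x = F (extChartAt (𝓡 n) x₀ x)) : Continuous f := by
  rw [continuous_iff_continuousAt]
  intro x
  obtain ⟨F, hF, hf⟩ := h x
  have h1 : ContinuousOn (F ∘ extChartAt (𝓡 n) x) (extChartAt (𝓡 n) x).source :=
    hF.comp (continuousOn_extChartAt x) (extChartAt (𝓡 n) x).mapsTo
  exact (h1.congr hf).continuousAt (extChartAt_source_mem_nhds x)

theorem IsSmoothFun.differentiableAt {f : M → ℝ} (hf : IsSmoothFun (n := n) f) {x₀ : M}
    {y : Coord n} (hy : y ∈ (extChartAt (𝓡 n) x₀).target) :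
    DifferentiableAt ℝ (f ∘ (extChartAt (𝓡 n) x₀).symm) y :=
  ((hf x₀).contDiffAt ((isOpen_extChartAt_target x₀).mem_nhds hy)).differentiableAt (by simp)

theorem IsSmoothFun.continuous {f : M → ℝ} (hf : IsSmoothFun (n := n) f) : Continuous f :=
  continuous_of_charts (n := n) fun x₀ => ⟨_, (hf x₀).continuousOn, fun x hx => by
    rw [Function.comp_apply, (extChartAt (𝓡 n) x₀).left_inv hx]⟩

theorem contract_act_sub (H : Matrix (Fin n) (Fin n) ℝ) (a : Coord n [⋀^Fin p]→L[ℝ] ℝ)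
    (w : (Fin p → Coord n) → ℝ) (S J : Coord n →L[ℝ] Coord n) :
    contract H (act (S - J) a) w = contract H (act S a) w - contract H (act J a) w := by
  have h : act S a = fun v => act (S - J) a v + act J a v := by
    funext v
    simp only [act, ← Finset.sum_add_distrib]
    refine Finset.sum_congr rfl fun k _ => ?_
    have := a.toMultilinearMap.map_update_add v k ((S - J) (v k)) (J (v k))
    rw [_root_.sub_apply, sub_add_cancel] at this
    exact this
  rw [h, contract_add_left]
  ring

variable [IsManifold (𝓡 n) ∞ M] {g : Metric n M} {θ : Form n M 1}
  {X : (x : M) → TangentSpace (𝓡 n) x}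

/-- Chain rule along the transition map to the chart around x. -/
theorem dirDeriv_eq {f : M → ℝ} (hf : IsSmoothFun (n := n) f)
    (X : (x : M) → TangentSpace (𝓡 n) x) {x₀ x : M} (hx : x ∈ (extChartAt (𝓡 n) x₀).source) :
    dirDeriv X f x = fderiv ℝ (f ∘ (extChartAt (𝓡 n) x₀).symm) (extChartAt (𝓡 n) x₀ x)
      (vecRep X x₀ (extChartAt (𝓡 n) x₀ x)) := by
  have hxx := mem_extChartAt_source (I := 𝓡 n) x
  have h1 : f ∘ (extChartAt (𝓡 n) x₀).symm =ᶠ[𝓝 (extChartAt (𝓡 n) x₀ x)]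
      (f ∘ (extChartAt (𝓡 n) x).symm) ∘ transition x₀ x := by
    filter_upwards [eventually_exists_extChartAt_eq hx hxx] with y hy
    obtain ⟨z, hz, hz', rfl⟩ := hy
    simp only [Function.comp_apply, transition_extChartAt hz]
    rw [(extChartAt (𝓡 n) x₀).left_inv hz, (extChartAt (𝓡 n) x).left_inv hz']
  have h2 : DifferentiableAt ℝ (f ∘ (extChartAt (𝓡 n) x).symm)
      (transition x₀ x (extChartAt (𝓡 n) x₀ x)) := by
    rw [transition_extChartAt hx]
    exact hf.differentiableAt ((extChartAt (𝓡 n) x).map_source hxx)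
  rw [h1.fderiv_eq, fderiv_comp _ h2 ((contDiffAt_transition hx hxx).differentiableAt (by simp)),
    ContinuousLinearMap.comp_apply, ← vecRep_transition X hx hxx, transition_extChartAt hx,
    vecRep_extChartAt _ hxx, toChart_self]
  rfl

theorem contract_chart (g : Metric n M) (α β : Form n M p) {x₀ x : M}
    (hx : x ∈ (extChartAt (𝓡 n) x₀).source) :
    contract (gram g x)⁻¹ (formAt α x) (formAt β x) =
      contract (metricRep g x₀ (extChartAt (𝓡 n) x₀ x))⁻¹ (formRep α x₀ (extChartAt (𝓡 n) x₀ x))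
        (formRep β x₀ (extChartAt (𝓡 n) x₀ x)) := by
  rw [formRep_extChartAt _ hx, formRep_extChartAt _ hx, ← contract_congr_matrix,
    metricRep_eq_transpose_mul g hx]
  have hu := isUnit_matOf_ofChart (n := n) hx
  have hu' : IsUnit (matOf (n := n) (ofChart x₀ x))ᵀ.det := by rwa [Matrix.det_transpose]
  congr 1
  rw [Matrix.mul_inv_rev, Matrix.mul_inv_rev, ← Matrix.mul_assoc, Matrix.mul_nonsing_inv _ hu,
    Matrix.one_mul, Matrix.mul_assoc, Matrix.nonsing_inv_mul _ hu', Matrix.mul_one]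

theorem formInner_eq (g : Metric n M) (α β : Form n M p) (x : M) :
    formInner g α β x =
      (p.factorial : ℝ)⁻¹ * contract (gram g x)⁻¹ (formAt α x) (formAt β x) := rfl

theorem formInner_chart (g : Metric n M) (α β : Form n M p) {x₀ x : M}
    (hx : x ∈ (extChartAt (𝓡 n) x₀).source) :
    formInner g α β x = (p.factorial : ℝ)⁻¹ *
      contract (metricRep g x₀ (extChartAt (𝓡 n) x₀ x))⁻¹ (formRep α x₀ (extChartAt (𝓡 n) x₀ x))
        (formRep β x₀ (extChartAt (𝓡 n) x₀ x)) := by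
  rw [formInner_eq, contract_chart g α β hx]

theorem isSmoothFun_formInner (g : Metric n M) {α β : Form n M p} (hα : IsSmooth α)
    (hβ : IsSmooth β) : IsSmoothFun (n := n) (formInner g α β) := by
  intro x₀
  have h : ∀ y ∈ (extChartAt (𝓡 n) x₀).target, (formInner g α β ∘ (extChartAt (𝓡 n) x₀).symm) y =
      (p.factorial : ℝ)⁻¹ * contract (metricRep g x₀ y)⁻¹ (formRep α x₀ y) (formRep β x₀ y) := by
    intro y hy
    rw [Function.comp_apply, formInner_chart g α β ((extChartAt (𝓡 n) x₀).map_target hy),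
      (extChartAt (𝓡 n) x₀).right_inv hy]
  refine ContDiffOn.congr ?_ h
  refine contDiffOn_const.mul ?_
  simp only [contract]
  have happ : ∀ {σ : Form n M p}, IsSmooth σ → ∀ v, ContDiffOn ℝ ∞ (fun y => formRep σ x₀ y v)
      (extChartAt (𝓡 n) x₀).target := fun hσ v =>
    (ContinuousAlternatingMap.apply ℝ (Coord n) ℝ v).contDiff.comp_contDiffOn (hσ x₀)
  refine ContDiffOn.sum fun I _ => ContDiffOn.sum fun J _ =>
    ContDiffOn.mul (ContDiffOn.mul ?_ ?_) ?_
  · exact contDiffOn_prod fun k _ => contDiffOn_metricRep_inv g x₀ _ _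
  · exact happ hα _
  · exact happ hβ _

theorem IsSmoothFun.continuous_dirDeriv {f : M → ℝ} (hf : IsSmoothFun (n := n) f)
    (hX : ∀ x₀ : M, ContDiffOn ℝ ∞ (vecRep X x₀) (extChartAt (𝓡 n) x₀).target) :
    Continuous (dirDeriv X f) := by
  refine continuous_of_charts (n := n) fun x₀ =>
    ⟨fun y => fderiv ℝ (f ∘ (extChartAt (𝓡 n) x₀).symm) y
    (vecRep X x₀ y), ?_, fun x hx => dirDeriv_eq hf X hx⟩
  exact ((hf x₀).continuousOn_fderiv_of_isOpen (isOpen_extChartAt_target x₀) (by simp)).clm_apply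
    (hX x₀).continuousOn

theorem contDiffOn_covMat (g : Metric n M)
    (hX : ∀ x₀ : M, ContDiffOn ℝ ∞ (vecRep X x₀) (extChartAt (𝓡 n) x₀).target) (x₀ : M)
    (k i : Fin n) :
    ContDiffOn ℝ ∞ (fun y => covMat g X x₀ y k i) (extChartAt (𝓡 n) x₀).target := by
  have hU := isOpen_extChartAt_target (I := 𝓡 n) x₀
  have hXk : ∀ k, ContDiffOn ℝ ∞ (fun y => vecRep X x₀ y k) (extChartAt (𝓡 n) x₀).target :=
    contDiffOn_euclidean.1 (hX x₀)
  have hd : ∀ {f : Coord n → ℝ}, ContDiffOn ℝ ∞ f (extChartAt (𝓡 n) x₀).target → ∀ v : Coord n,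
      ContDiffOn ℝ ∞ (fun y => fderiv ℝ f y v) (extChartAt (𝓡 n) x₀).target := fun hf v =>
    (hf.fderiv_of_isOpen (m := ∞) hU (by simp)).clm_apply contDiffOn_const
  refine (hd (hXk k) _).add (ContDiffOn.sum fun j _ => ContDiffOn.mul ?_ (hXk j))
  refine contDiffOn_const.mul (ContDiffOn.sum fun l _ => (contDiffOn_metricRep_inv g x₀ k l).mul ?_)
  exact ((hd (contDiffOn_metricRep g x₀ _ _) _).add (hd (contDiffOn_metricRep g x₀ _ _) _)).sub
    (hd (contDiffOn_metricRep g x₀ _ _) _)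

theorem continuous_divergence (h : IsDual g θ X) (hθ : IsSmooth θ) (hcl : ∀ x, extDer θ x = 0) :
    Continuous (divergence g X) := by
  refine continuous_of_charts (n := n) fun x₀ => ⟨fun y => (covMat g X x₀ y).trace, ?_,
    fun x hx => divergence_eq_trace h hθ hcl hx⟩
  exact continuousOn_finsetSum _ fun i _ =>
    (contDiffOn_covMat g (h.contDiffOn hθ) x₀ i i).continuousOn

theorem continuous_gradNorm (h : IsDual g θ X) (hθ : IsSmooth θ) (hcl : ∀ x, extDer θ x = 0) :
    Continuous (gradNorm g X) := by
  refine continuous_of_charts (n := n) fun x₀ =>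
    ⟨fun y => √(hsSq (metricRep g x₀ y) (covMat g X x₀ y)), ?_,
    fun x hx => gradNorm_eq_sqrt_hsSq h hθ hcl hx⟩
  refine ContinuousOn.sqrt ?_
  have hS := fun i j => (contDiffOn_covMat g (h.contDiffOn hθ) x₀ i j).continuousOn
  exact continuousOn_finsetSum _ fun i _ => continuousOn_finsetSum _ fun j _ =>
    continuousOn_finsetSum _ fun k _ => continuousOn_finsetSum _ fun l _ =>
      ((((contDiffOn_metricRep_inv g x₀ i j).continuousOn).mul
        (contDiffOn_metricRep g x₀ k l).continuousOn).mul (hS k i)).mul (hS l j)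

theorem gram_inv_posDef (g : Metric n M) (x : M) : ((gram g x)⁻¹).PosDef := (gram_posDef g x).inv

theorem gram_inv_transpose (g : Metric n M) (x : M) : ((gram g x)⁻¹)ᵀ = (gram g x)⁻¹ := by
  rw [Matrix.transpose_nonsing_inv, gram_transpose]

theorem formInner_self_nonneg (g : Metric n M) (α : Form n M p) (x : M) :
    0 ≤ formInner g α α x := by
  rw [formInner_eq]
  exact mul_nonneg (by positivity) (contract_self_nonneg _ (gram_inv_posDef g x) _)

theorem formInner_eq_zero_of_self {α : Form n M p} {x : M} (h : formInner g α α x = 0)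
    (β : Form n M p) : formInner g α β x = 0 := by
  rw [formInner_eq] at h ⊢
  have : (p.factorial : ℝ)⁻¹ ≠ 0 := by positivity
  rw [contract_eq_zero_of_self _ (gram_inv_posDef g x) ((mul_eq_zero.1 h).resolve_left this),
    mul_zero]

theorem formInner_comm (g : Metric n M) (α β : Form n M p) (x : M) :
    formInner g α β x = formInner g β α x := by
  rw [formInner_eq, formInner_eq, contract_comm, gram_inv_transpose]

theorem formInner_add_left (g : Metric n M) (α β γ : Form n M p) (x : M) :
    formInner g (fun x => α x + β x) γ x = formInner g α γ x + formInner g β γ x := by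
  rw [formInner_eq, formInner_eq, formInner_eq, ← mul_add, ← contract_add_left]
  rfl

theorem sharp_gram_inv (h : IsDual g θ X) (x : M) : sharp (gram g x)⁻¹ (formAt θ x) = X x := by
  have hxx := mem_extChartAt_source (I := 𝓡 n) x
  have h1 := h.vecRep_eq ((extChartAt (𝓡 n) x).map_source hxx)
  rw [vecRep_extChartAt _ hxx, toChart_self, metricRep_self, formRep_extChartAt _ hxx,
    ofChart_self] at h1
  exact h1.symm

/-- The factor p + 1 of `contract_wedgeCovector` turns 1/(p+1)! into 1/p!, so θ ∧ and ι_X are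
adjoint at every point. -/
theorem formInner_wedge (h : IsDual g θ X) (β : Form n M p) (α : Form n M (p + 1)) (x : M) :
    formInner g (wedge θ β) α x = formInner g β (interiorMul X α) x := by
  have h1 := contract_wedgeCovector (gram g x)⁻¹ (formAt θ x) (formAt β x) (formAt α x)
  rw [sharp_gram_inv h] at h1
  have h2 : formInner g (wedge θ β) α x = ((p + 1).factorial : ℝ)⁻¹ *
    contract (gram g x)⁻¹ (wedgeCovector (formAt θ x) (formAt β x)) (formAt α x) := rfl
  have h3 : formInner g β (interiorMul X α) x = (p.factorial : ℝ)⁻¹ *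
    contract (gram g x)⁻¹ (formAt β x) ((formAt α x).curryLeft (X x)) := rfl
  rw [h2, h1, h3, Nat.factorial_succ]
  push_cast
  field_simp

/-- Pairs the anticommutation rule ι_X(θ ∧ α) + θ ∧ ι_X α = θ(X) α with α, after rewriting |ι_X α|²
by adjointness. -/
theorem formInner_interiorMul_wedge (h : IsDual g θ X) (α : Form n M (p + 1)) (x : M) :
    formInner g (interiorMul X (wedge θ α)) α x +
      formInner g (interiorMul X α) (interiorMul X α) x =
        g.inner x (X x) (X x) * formInner g α α x := by
  rw [← formInner_wedge h, ← formInner_add_left]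
  have h1 := curryLeft_wedgeCovector (formAt θ x) (formAt α x) (X x)
  have h2 : formInner g (fun x => interiorMul X (wedge θ α) x + wedge θ (interiorMul X α) x) α x =
      ((p + 1).factorial : ℝ)⁻¹ * contract (gram g x)⁻¹
        (((wedgeCovector (formAt θ x) (formAt α x)).curryLeft (X x) +
          wedgeCovector (formAt θ x) ((formAt α x).curryLeft (X x)) :
            Coord n [⋀^Fin (p + 1)]→L[ℝ] ℝ)) (formAt α x) := rfl
  rw [h2, h1, h x (X x), formInner_eq]
  have h3 : ⇑((formAt θ x (fun _ => X x)) • formAt α x) =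
      fun v => formAt θ x (fun _ => X x) * formAt α x v := rfl
  rw [h3, contract_smul_left]
  have h4 : formAt θ x (fun _ => X x) = θ x (fun _ => X x) := rfl
  rw [h4]
  ring

theorem formInner_interiorMul_wedge_zero (h : IsDual g θ X) (α : Form n M 0) (x : M) :
    formInner g (interiorMul X (wedge θ α)) α x = g.inner x (X x) (X x) * formInner g α α x := by
  have h1 := curryLeft_wedgeCovector_zero (formAt θ x) (formAt α x) (X x)
  have h2 : formInner g (interiorMul X (wedge θ α)) α x =
      ((0).factorial : ℝ)⁻¹ * contract (gram g x)⁻¹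
        ((wedgeCovector (formAt θ x) (formAt α x)).curryLeft (X x)) (formAt α x) := rfl
  rw [h2, h1, h x (X x), formInner_eq]
  have h3 : ⇑((formAt θ x (fun _ => X x)) • formAt α x) =
      fun v => formAt θ x (fun _ => X x) * formAt α x v := rfl
  rw [h3, contract_smul_left]
  have h4 : formAt θ x (fun _ => X x) = θ x (fun _ => X x) := rfl
  rw [h4]
  ring

/-- The defect between the Lie derivative and the covariant derivative. -/
def gradAction (g : Metric n M) (X : (x : M) → TangentSpace (𝓡 n) x) (α : Form n M p) (x : M) : ℝ :=
  (p.factorial : ℝ)⁻¹ * contract (gram g x)⁻¹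
    (act (ofMat (covMat g X x (extChartAt (𝓡 n) x x))) (formAt α x)) (formAt α x)

/-- The factor p n of the algebraic estimate is at most n² when p ≤ n, and in higher degree the form
is zero. -/
theorem abs_gradAction_le (h : IsDual g θ X) (hθ : IsSmooth θ) (hcl : ∀ x, extDer θ x = 0)
    (α : Form n M p) (x : M) :
    |gradAction g X α x| ≤ n ^ 2 * (gradNorm g X x * formInner g α α x) := by
  rcases lt_or_ge n p with hp | hp
  · have h0 : formAt α x = 0 := eq_zero_of_lt hp _
    have h1 : gradAction g X α x = 0 := by
      rw [gradAction, h0]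
      simp [contract]
    have h2 : formInner g α α x = 0 := by
      rw [formInner_eq, h0]
      simp [contract]
    rw [h1, h2]
    simp
  · have h1 := abs_contract_act_le (gram_posDef g x) (ofMat (covMat g X x (extChartAt (𝓡 n) x x)))
      (formAt α x)
    have h2 := gradNorm_eq_sqrt_hsSq h hθ hcl (mem_extChartAt_source (I := 𝓡 n) x)
    rw [metricRep_self] at h2
    rw [matOf_ofMat, ← h2] at h1
    have hg : 0 ≤ gradNorm g X x := Real.sqrt_nonneg _
    have hf := formInner_self_nonneg g α x
    have hp' : (p : ℝ) ≤ n := by exact_mod_cast hp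
    rw [gradAction, abs_mul, abs_of_nonneg (by positivity)]
    calc _ ≤ (p.factorial : ℝ)⁻¹ * (p * n * gradNorm g X x *
          contract (gram g x)⁻¹ (formAt α x) (formAt α x)) :=
          mul_le_mul_of_nonneg_left h1 (by positivity)
      _ = p * (n * (gradNorm g X x * formInner g α α x)) := by rw [formInner_eq]; ring
      _ ≤ n * (n * (gradNorm g X x * formInner g α α x)) :=
          mul_le_mul_of_nonneg_right hp' (by positivity)
      _ = _ := by ring

/-- The left side is ⟨L_X α, α⟩ in coordinates, that is ⟨∂_X α + J·α, α⟩ with J the Jacobian of X.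
With S = ∇X, the inverse metric varies along X by minus the action of S - J, so ½ X|α|² = ⟨∂_X α, α⟩
- ⟨(S - J)·α, α⟩; the J terms match and the S term is the gradient action. A first derivative
depends only on the direction, so a straight line in the chart replaces the flow of X. -/
theorem lie_derivative_identity (h : IsDual g θ X) (hθ : IsSmooth θ) (hcl : ∀ x, extDer θ x = 0)
    {α : Form n M p} (hα : IsSmooth α) (x : M) :
    (p.factorial : ℝ)⁻¹ * contract (gram g x)⁻¹
      (fun v => fderiv ℝ (formRep α x) (extChartAt (𝓡 n) x x) (X x) v +
        act (fderiv ℝ (vecRep X x) (extChartAt (𝓡 n) x x)) (formAt α x) v) (formAt α x) =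
      2⁻¹ * dirDeriv X (formInner g α α) x + gradAction g X α x := by
  set y := extChartAt (𝓡 n) x x with hy
  have hxx := mem_extChartAt_source (I := 𝓡 n) x
  have hyt : y ∈ (extChartAt (𝓡 n) x).target := (extChartAt (𝓡 n) x).map_source hxx
  have hvec : vecRep X x y = X x := by
    rw [hy, vecRep_extChartAt _ hxx, toChart_self]; rfl
  have hform : formRep α x y = formAt α x := by
    rw [hy, formRep_extChartAt _ hxx, ofChart_self]; rfl
  have hG : metricRep g x y = gram g x := metricRep_self g x
  set J := fderiv ℝ (vecRep X x) y with hJ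
  set S := ofMat (covMat g X x y) with hS
  have hmem : ∀ᶠ t : ℝ in 𝓝 0, y + t • vecRep X x y ∈ (extChartAt (𝓡 n) x).target :=
    (tendsto_line y _).eventually ((isOpen_extChartAt_target x).mem_nhds hyt)
  have hGd : ∀ i j, HasDerivAt (fun t : ℝ => metricRep g x (y + t • vecRep X x y) i j)
      (((matOf (S - J))ᵀ * metricRep g x (y + (0 : ℝ) • vecRep X x y) +
        metricRep g x (y + (0 : ℝ) • vecRep X x y) * matOf (S - J)) i j) 0 := by
    intro i j
    have h1 := hasDerivAt_metricRep_line g hyt (vecRep X x y) i j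
    rw [dirMat_eq h hθ hcl hyt] at h1
    rwa [zero_smul, add_zero, matOf_sub, hS, matOf_ofMat]
  have hHd : ∀ i j, HasDerivAt (fun t : ℝ => (metricRep g x (y + t • vecRep X x y))⁻¹ i j)
      ((-(matOf (S - J) * (metricRep g x (y + (0 : ℝ) • vecRep X x y))⁻¹ +
        (metricRep g x (y + (0 : ℝ) • vecRep X x y))⁻¹ * (matOf (S - J))ᵀ)) i j) 0 := by
    refine hasDerivAt_inv hGd ?_ ?_
    · filter_upwards [hmem] with t ht
      exact isUnit_metricRep_det g ht
    · intro i j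
      exact (hasDerivAt_comp_line (((contDiffOn_metricRep_inv g x i j).contDiffAt
        ((isOpen_extChartAt_target x).mem_nhds hyt)).differentiableAt (by simp))
          (vecRep X x y)).differentiableAt
  have hαd := hasDerivAt_comp_line ((hα.contDiffAt hyt).differentiableAt (by simp)) (vecRep X x y)
  have h1 := (hasDerivAt_contract (S - J) hHd rfl hαd hαd).const_mul (p.factorial : ℝ)⁻¹
  have h2 : HasDerivAt (fun t : ℝ => (formInner g α α ∘ (extChartAt (𝓡 n) x).symm)
      (y + t • vecRep X x y)) (dirDeriv X (formInner g α α) x) 0 := by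
    rw [dirDeriv, ← hvec]
    exact hasDerivAt_comp_line ((isSmoothFun_formInner g hα hα).differentiableAt hyt) _
  have h3 := h2.unique (h1.congr_of_eventuallyEq (by
    filter_upwards [hmem] with t ht
    rw [Function.comp_apply, formInner_chart g α α ((extChartAt (𝓡 n) x).map_target ht),
      (extChartAt (𝓡 n) x).right_inv ht]))
  rw [zero_smul, add_zero, hG, hform, contract_comm _ (formAt α x), gram_inv_transpose,
    contract_comm _ (formAt α x) (act _ _), gram_inv_transpose, contract_act_sub, hvec] at h3
  rw [h3, contract_add_left, gradAction]
  ring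

/-- Cartan's formula read in the chart around x, followed by the coordinate identity for ⟨L_X α, α⟩.
-/
theorem lie_identity (h : IsDual g θ X) (hθ : IsSmooth θ) (hcl : ∀ x, extDer θ x = 0)
    {α : Form n M (p + 1)} (hα : IsSmooth α) (x : M) :
    formInner g (extDer (interiorMul X α)) α x + formInner g (interiorMul X (extDer α)) α x =
      2⁻¹ * dirDeriv X (formInner g α α) x + gradAction g X α x := by
  have hxx := mem_extChartAt_source (I := 𝓡 n) x
  have hyt := (extChartAt (𝓡 n) x).map_source hxx
  rw [← lie_derivative_identity h hθ hcl hα]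
  have hvec : vecRep X x (extChartAt (𝓡 n) x x) = X x := by
    rw [vecRep_extChartAt _ hxx, toChart_self]; rfl
  have hform : ∀ {q : ℕ} (σ : Form n M q), formRep σ x (extChartAt (𝓡 n) x x) = formAt σ x := by
    intro q σ
    rw [formRep_extChartAt _ hxx, ofChart_self]; rfl
  have h1 := extDeriv_curryLeft_add ((hα.contDiffAt hyt).differentiableAt (by simp))
    (((h.contDiffOn hθ x).contDiffAt
      ((isOpen_extChartAt_target x).mem_nhds hyt)).differentiableAt (by simp))
  have h2 : extDeriv (fun z => (formRep α x z).curryLeft (vecRep X x z)) (extChartAt (𝓡 n) x x) =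
      formAt (extDer (interiorMul X α)) x := by
    rw [← hform, formRep_extDer (h.isSmooth_interiorMul hθ hα) hyt]
    refine Filter.EventuallyEq.extDeriv_eq ?_
    filter_upwards [(isOpen_extChartAt_target x).mem_nhds hyt] with z hz
    exact (formRep_interiorMul X α hz).symm
  rw [h2, ← formRep_extDer hα hyt, hform, hform, hvec] at h1
  rw [← h1, formInner_eq, formInner_eq, ← mul_add, ← contract_add_left]
  rfl

theorem lie_identity_zero (h : IsDual g θ X) (hθ : IsSmooth θ) (hcl : ∀ x, extDer θ x = 0)
    {α : Form n M 0} (hα : IsSmooth α) (x : M) :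
    formInner g (interiorMul X (extDer α)) α x =
      2⁻¹ * dirDeriv X (formInner g α α) x + gradAction g X α x := by
  have hxx := mem_extChartAt_source (I := 𝓡 n) x
  have hyt := (extChartAt (𝓡 n) x).map_source hxx
  rw [← lie_derivative_identity h hθ hcl hα]
  have hform : ∀ {q : ℕ} (σ : Form n M q), formRep σ x (extChartAt (𝓡 n) x x) = formAt σ x := by
    intro q σ
    rw [formRep_extChartAt _ hxx, ofChart_self]; rfl
  have h1 := extDeriv_curryLeft_zero (formRep α x) (X x) (extChartAt (𝓡 n) x x)
  rw [← formRep_extDer hα hyt, hform] at h1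
  rw [formInner_eq, ← h1]
  congr 2
  funext v
  simp [act]
  rfl

end Pointwise

end MorseNovikov

namespace MorseNovikov

/-! ### The Riemannian volume measure -/

section Volume

open Matrix Filter Set MeasureTheory
open scoped Topology

variable {n : ℕ} {M : Type*} [TopologicalSpace M] [ChartedSpace (EuclideanSpace ℝ (Fin n)) M]

theorem det_eq_det_matOf (L : Coord n →L[ℝ] Coord n) : L.det = (matOf L).det := by
  have h := LinearMap.det_toMatrix (EuclideanSpace.basisFun (Fin n) ℝ).toBasis
    (L : Coord n →ₗ[ℝ] Coord n)
  rw [ContinuousLinearMap.det, ← h]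
  congr 1

theorem sqrt_det_congr (P G : Matrix (Fin n) (Fin n) ℝ) :
    √(Pᵀ * G * P).det = |P.det| * √G.det := by
  rw [Matrix.det_mul, Matrix.det_mul, Matrix.det_transpose,
    show P.det * G.det * P.det = P.det ^ 2 * G.det by ring, Real.sqrt_mul (sq_nonneg _),
    Real.sqrt_sq_eq_abs]

theorem measurableSet_target (x₀ : M) :
    MeasurableSet ((extChartAt (𝓡 n) x₀).target) :=
  (isOpen_extChartAt_target (I := 𝓡 n) x₀).measurableSet

theorem continuousOn_sqrt_det [IsManifold (𝓡 n) ∞ M] (g : Metric n M) (x₀ : M) :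
    ContinuousOn (fun y => √(metricRep g x₀ y).det) (extChartAt (𝓡 n) x₀).target :=
  (contDiffOn_matrix_det fun i j => contDiffOn_metricRep g x₀ i j).continuousOn.sqrt

variable [MeasurableSpace M] [BorelSpace M]

theorem measurableSet_source (x₀ : M) : MeasurableSet (extChartAt (𝓡 n) x₀).source :=
  (isOpen_extChartAt_source (I := 𝓡 n) x₀).measurableSet

theorem measurableSet_target_inter_preimage (x₀ : M) {A : Set M} (hA : MeasurableSet A) :
    MeasurableSet ((extChartAt (𝓡 n) x₀).target ∩ (extChartAt (𝓡 n) x₀).symm ⁻¹' A) := by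
  have h1 : Measurable ((extChartAt (𝓡 n) x₀).target.domRestrict (extChartAt (𝓡 n) x₀).symm) :=
    (continuousOn_iff_continuous_domRestrict.1
      (continuousOn_extChartAt_symm (I := 𝓡 n) x₀)).measurable
  have h2 := (measurableSet_target (n := n) x₀).subtype_image (h1 hA)
  convert h2 using 1
  ext y
  refine ⟨fun h => ⟨⟨y, h.1⟩, h.2, rfl⟩, ?_⟩
  rintro ⟨⟨z, hz⟩, hzA, rfl⟩
  exact ⟨hz, hzA⟩

variable [IsManifold (𝓡 n) ∞ M]

theorem aemeasurable_symm (g : Metric n M) (x₀ : M) :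
    AEMeasurable (extChartAt (𝓡 n) x₀).symm
      (((volume : Measure (Coord n)).restrict (extChartAt (𝓡 n) x₀).target).withDensity
        (fun y => ENNReal.ofReal (√(metricRep g x₀ y).det))) := by
  refine AEMeasurable.mono_ac ?_ (withDensity_absolutelyContinuous _ _)
  exact (continuousOn_extChartAt_symm x₀).aemeasurable (measurableSet_target x₀)

theorem chartVolume_apply (g : Metric n M) (x₀ : M) {A : Set M} (hA : MeasurableSet A) :
    chartVolume g x₀ A = ∫⁻ y in (extChartAt (𝓡 n) x₀).target ∩ (extChartAt (𝓡 n) x₀).symm ⁻¹' A,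
      ENNReal.ofReal (√(metricRep g x₀ y).det) := by
  rw [chartVolume, Measure.map_apply_of_aemeasurable (aemeasurable_symm g x₀) hA,
    withDensity_apply', Measure.restrict_restrict' (measurableSet_target x₀), inter_comm]

theorem chartVolume_compl_source (g : Metric n M) (x₀ : M) :
    chartVolume g x₀ (extChartAt (𝓡 n) x₀).sourceᶜ = 0 := by
  rw [chartVolume_apply g x₀ (measurableSet_source x₀).compl]
  have : (extChartAt (𝓡 n) x₀).target ∩
      (extChartAt (𝓡 n) x₀).symm ⁻¹' (extChartAt (𝓡 n) x₀).sourceᶜ = ∅ := by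
    ext y
    simp only [mem_inter_iff, mem_preimage, mem_compl_iff, mem_empty_iff_false, iff_false, not_and,
      not_not]
    exact fun hy => (extChartAt (𝓡 n) x₀).map_target hy
  rw [this, Measure.restrict_empty, lintegral_zero_measure]

/-- Change of variables along the transition map: its Jacobian |det P| is exactly the factor by
which √(det g_ij) changes. -/
theorem chartVolume_eq_of_subset (g : Metric n M) (x₀ x₁ : M) {A : Set M} (hA : MeasurableSet A)
    (h₀ : A ⊆ (extChartAt (𝓡 n) x₀).source) (h₁ : A ⊆ (extChartAt (𝓡 n) x₁).source) :
    chartVolume g x₁ A = chartVolume g x₀ A := by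
  rw [chartVolume_apply g x₁ hA, chartVolume_apply g x₀ hA]
  set B := (extChartAt (𝓡 n) x₀).target ∩ (extChartAt (𝓡 n) x₀).symm ⁻¹' A with hB
  have hBA : ∀ y ∈ B, ∃ x ∈ A, extChartAt (𝓡 n) x₀ x = y := fun y hy =>
    ⟨_, hy.2, (extChartAt (𝓡 n) x₀).right_inv hy.1⟩
  have himg : (extChartAt (𝓡 n) x₁).target ∩ (extChartAt (𝓡 n) x₁).symm ⁻¹' A =
      transition x₀ x₁ '' B := by
    ext y
    constructor
    · rintro ⟨hy, hyA⟩
      refine ⟨extChartAt (𝓡 n) x₀ ((extChartAt (𝓡 n) x₁).symm y),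
        ⟨(extChartAt (𝓡 n) x₀).map_source (h₀ hyA), ?_⟩, ?_⟩
      · rw [mem_preimage, (extChartAt (𝓡 n) x₀).left_inv (h₀ hyA)]
        exact hyA
      · rw [transition_extChartAt (h₀ hyA), (extChartAt (𝓡 n) x₁).right_inv hy]
    · rintro ⟨z, hz, rfl⟩
      obtain ⟨x, hx, rfl⟩ := hBA z hz
      rw [transition_extChartAt (h₀ hx)]
      refine ⟨(extChartAt (𝓡 n) x₁).map_source (h₁ hx), ?_⟩
      rw [mem_preimage, (extChartAt (𝓡 n) x₁).left_inv (h₁ hx)]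
      exact hx
  have hd : ∀ y ∈ B, HasFDerivWithinAt (transition x₀ x₁ : Coord n → Coord n)
      (fderiv ℝ (transition x₀ x₁) y) B y := by
    intro y hy
    obtain ⟨x, hx, rfl⟩ := hBA y hy
    exact ((contDiffAt_transition (h₀ hx) (h₁ hx)).differentiableAt
      (by simp)).hasFDerivAt.hasFDerivWithinAt
  have hinj : InjOn (transition x₀ x₁ : Coord n → Coord n) B := by
    intro y hy z hz hyz
    obtain ⟨x, hx, rfl⟩ := hBA y hy
    obtain ⟨w, hw, rfl⟩ := hBA z hz
    rw [transition_extChartAt (h₀ hx), transition_extChartAt (h₀ hw)] at hyz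
    rw [(extChartAt (𝓡 n) x₁).injOn (h₁ hx) (h₁ hw) hyz]
  have hBm : MeasurableSet B := measurableSet_target_inter_preimage x₀ hA
  rw [himg, lintegral_image_eq_lintegral_abs_det_fderiv_mul volume hBm hd hinj]
  refine setLIntegral_congr_fun hBm fun y hy => ?_
  obtain ⟨x, hx, rfl⟩ := hBA y hy
  rw [metricRep_transition g (h₀ hx) (h₁ hx), sqrt_det_congr, det_eq_det_matOf,
    ENNReal.ofReal_mul (abs_nonneg _)]

/-- For the upper bound it is enough to find one measure that dominates every chart volume and
restricts correctly: the volume of the chart around x₀, plus the supremum restricted to the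
complement of that chart's domain. -/
theorem riemannianVolume_restrict_source (g : Metric n M) (x₀ : M) :
    (riemannianVolume g).restrict (extChartAt (𝓡 n) x₀).source = chartVolume g x₀ := by
  have hs := measurableSet_source (n := n) x₀
  have hres : (chartVolume g x₀).restrict (extChartAt (𝓡 n) x₀).source = chartVolume g x₀ :=
    Measure.restrict_eq_self_of_ae_mem (by
      rw [ae_iff]; exact chartVolume_compl_source g x₀)
  refine le_antisymm ?_ ?_
  · have hle : riemannianVolume g ≤
        chartVolume g x₀ + (riemannianVolume g).restrict (extChartAt (𝓡 n) x₀).sourceᶜ := by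
      refine iSup_le fun x₁ => Measure.le_iff.2 fun A hA => ?_
      rw [← measure_inter_add_sdiff A hs, Measure.add_apply]
      refine add_le_add ?_ ?_
      -- Inside the domain around x₀ the measure of the chart around x₁ lives on the overlap, where
      -- the two chart volumes agree.
      · rw [← measure_inter_add_sdiff _ (measurableSet_source (n := n) x₁)]
        have h0 : chartVolume g x₁ ((A ∩ (extChartAt (𝓡 n) x₀).source) \
            (extChartAt (𝓡 n) x₁).source) = 0 :=
          measure_mono_null (fun x hx => hx.2) (chartVolume_compl_source g x₁)
        rw [h0, add_zero, chartVolume_eq_of_subset g x₀ x₁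
          ((hA.inter hs).inter (measurableSet_source x₁)) (fun x hx => hx.1.2) fun x hx => hx.2]
        exact measure_mono fun x hx => hx.1.1
      · rw [Measure.restrict_apply hA]
        exact Measure.le_iff'.1 (le_iSup (fun x => chartVolume g x) x₁) _
    refine (Measure.restrict_mono le_rfl hle).trans ?_
    rw [Measure.restrict_add, hres, Measure.restrict_restrict hs, inter_compl_self,
      Measure.restrict_empty, add_zero]
  · conv_lhs => rw [← hres]
    exact Measure.restrict_mono le_rfl (le_iSup (fun x => chartVolume g x) x₀)

/-- The density √(det g_ij) is continuous, hence bounded on a closed coordinate ball. On compact M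
this makes continuous functions integrable. -/
theorem isLocallyFiniteMeasure_riemannianVolume (g : Metric n M) :
    IsLocallyFiniteMeasure (riemannianVolume g) := by
  refine ⟨fun x => ?_⟩
  have hxx := mem_extChartAt_source (I := 𝓡 n) x
  obtain ⟨r, hr, hrt⟩ := Metric.nhds_basis_closedBall.mem_iff.1
    ((isOpen_extChartAt_target x).mem_nhds ((extChartAt (𝓡 n) x).map_source hxx))
  have hK := isCompact_closedBall (extChartAt (𝓡 n) x x) r
  obtain ⟨C, hC⟩ := hK.bddAbove_image ((continuousOn_sqrt_det g x).mono hrt)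
  set V := (extChartAt (𝓡 n) x).source ∩
    extChartAt (𝓡 n) x ⁻¹' Metric.ball (extChartAt (𝓡 n) x x) r
  have hVo : IsOpen V := isOpen_extChartAt_preimage' x Metric.isOpen_ball
  refine ⟨V, hVo.mem_nhds ⟨hxx, Metric.mem_ball_self hr⟩, ?_⟩
  have h1 : riemannianVolume g V = chartVolume g x V := by
    rw [← riemannianVolume_restrict_source, Measure.restrict_apply hVo.measurableSet,
      inter_eq_left.2 inter_subset_left]
  rw [h1, chartVolume_apply g x hVo.measurableSet]
  have hsub : (extChartAt (𝓡 n) x).target ∩ (extChartAt (𝓡 n) x).symm ⁻¹' V ⊆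
      Metric.closedBall (extChartAt (𝓡 n) x x) r := by
    rintro y ⟨hy, -, hy2⟩
    rw [mem_preimage, (extChartAt (𝓡 n) x).right_inv hy] at hy2
    exact Metric.ball_subset_closedBall hy2
  calc _ ≤ ∫⁻ y in Metric.closedBall (extChartAt (𝓡 n) x x) r,
        ENNReal.ofReal (√(metricRep g x y).det) := lintegral_mono_set hsub
    _ ≤ ∫⁻ _ in Metric.closedBall (extChartAt (𝓡 n) x x) r, ENNReal.ofReal C :=
        setLIntegral_mono' Metric.isClosed_closedBall.measurableSet fun y hy =>
          ENNReal.ofReal_le_ofReal (hC (mem_image_of_mem _ hy))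
    _ < ⊤ := by
        rw [setLIntegral_const]
        exact ENNReal.mul_lt_top ENNReal.ofReal_lt_top hK.measure_lt_top

theorem integrable_of_continuous [CompactSpace M] (g : Metric n M) {f : M → ℝ}
    (hf : Continuous f) : Integrable f (riemannianVolume g) := by
  have := isLocallyFiniteMeasure_riemannianVolume g
  exact hf.integrable_of_hasCompactSupport (HasCompactSupport.of_compactSpace f)

theorem integral_eq_integral_chart (g : Metric n M) (x₀ : M) {f : M → ℝ} (hf : Continuous f)
    (h0 : ∀ x, x ∉ (extChartAt (𝓡 n) x₀).source → f x = 0) :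
    ∫ x, f x ∂(riemannianVolume g) = ∫ y in (extChartAt (𝓡 n) x₀).target,
      √(metricRep g x₀ y).det * f ((extChartAt (𝓡 n) x₀).symm y) := by
  rw [← setIntegral_eq_integral_of_forall_compl_eq_zero h0, riemannianVolume_restrict_source,
    chartVolume, integral_map (aemeasurable_symm g x₀) hf.aestronglyMeasurable,
    integral_withDensity_eq_integral_toReal_smul₀]
  · refine integral_congr_ae (ae_of_all _ fun y => ?_)
    simp only [smul_eq_mul]
    rw [ENNReal.toReal_ofReal (Real.sqrt_nonneg _)]
  · exact ((continuousOn_sqrt_det g x₀).aemeasurable (measurableSet_target x₀)).ennreal_ofReal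
  · exact ae_of_all _ fun y => ENNReal.ofReal_lt_top

end Volume

end MorseNovikov

namespace MorseNovikov

/-! ### The divergence theorem -/

section Divergence

open Matrix Filter Set MeasureTheory
open scoped Topology

variable {n : ℕ} {M : Type*} [TopologicalSpace M] [ChartedSpace (EuclideanSpace ℝ (Fin n)) M]
  {X : (x : M) → TangentSpace (𝓡 n) x}

theorem isSmoothFun_of_contMDiff [IsManifold (𝓡 n) ∞ M] {f : M → ℝ}
    (hf : ContMDiff (𝓡 n) 𝓘(ℝ, ℝ) ∞ f) : IsSmoothFun (n := n) f := fun x₀ =>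
  contMDiffOn_iff_contDiffOn.1 (hf.comp_contMDiffOn (contMDiffOn_extChartAt_symm x₀))

theorem IsSmoothFun.mul {f h : M → ℝ} (hf : IsSmoothFun (n := n) f)
    (hh : IsSmoothFun (n := n) h) : IsSmoothFun (n := n) (fun x => f x * h x) := fun x₀ =>
  (hf x₀).mul (hh x₀)

theorem dirDeriv_sum {ι : Type*} (s : Finset ι) {f : ι → M → ℝ}
    (hf : ∀ i ∈ s, IsSmoothFun (n := n) (f i)) (x : M) :
    dirDeriv X (fun x => ∑ i ∈ s, f i x) x = ∑ i ∈ s, dirDeriv X (f i) x := by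
  have h : (fun x => ∑ i ∈ s, f i x) ∘ (extChartAt (𝓡 n) x).symm =
      fun y => ∑ i ∈ s, (f i ∘ (extChartAt (𝓡 n) x).symm) y := rfl
  simp only [dirDeriv]
  rw [h, fderiv_fun_sum fun i hi => (hf i hi).differentiableAt (mem_extChartAt_target x)]
  exact map_sum (ContinuousLinearMap.apply ℝ ℝ (show Coord n from X x)) _ s

variable [IsManifold (𝓡 n) ∞ M] {g : Metric n M} {θ : Form n M 1}

theorem contDiffOn_sqrt_det (g : Metric n M) (x₀ : M) :
    ContDiffOn ℝ ∞ (fun y => √(metricRep g x₀ y).det) (extChartAt (𝓡 n) x₀).target :=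
  (contDiffOn_matrix_det fun i j => contDiffOn_metricRep g x₀ i j).sqrt
    fun _ hy => (metricRep_posDef g hy).det_pos.ne'

theorem fderiv_sqrt_det (h : IsDual g θ X) (hθ : IsSmooth θ) (hcl : ∀ x, extDer θ x = 0)
    {x₀ : M} {y : Coord n} (hy : y ∈ (extChartAt (𝓡 n) x₀).target) :
    fderiv ℝ (fun z => √(metricRep g x₀ z).det) y (vecRep X x₀ y) =
      √(metricRep g x₀ y).det *
        (covMat g X x₀ y - matOf (fderiv ℝ (vecRep X x₀) y)).trace := by
  have hU := (isOpen_extChartAt_target (I := 𝓡 n) x₀).mem_nhds hy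
  have h1 := hasDerivAt_comp_line (((contDiffOn_sqrt_det g x₀).contDiffAt hU).differentiableAt
    (by simp)) (vecRep X x₀ y)
  have h2 : HasDerivAt (fun t : ℝ => √(metricRep g x₀ (y + t • vecRep X x₀ y)).det)
      (√(metricRep g x₀ (y + (0 : ℝ) • vecRep X x₀ y)).det *
        (covMat g X x₀ y - matOf (fderiv ℝ (vecRep X x₀) y)).trace) 0 := by
    refine hasDerivAt_sqrt_det (fun i j => ?_) ?_
    · have h1 := hasDerivAt_metricRep_line g hy (vecRep X x₀ y) i j
      rw [dirMat_eq h hθ hcl hy] at h1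
      rwa [zero_smul, add_zero]
    · rw [zero_smul, add_zero]
      exact (metricRep_posDef g hy).det_pos
  rw [zero_smul, add_zero] at h2
  exact h1.unique h2

/-- The coordinate formula div(fX) = (det g)^{-1/2} ∂_i((det g)^{1/2} f X^i). The density
contributes tr(S - J) and the derivatives of the X^i contribute tr J, leaving tr S = div X. -/
theorem sum_fderiv_density (h : IsDual g θ X) (hθ : IsSmooth θ) (hcl : ∀ x, extDer θ x = 0)
    {x₀ : M} {y : Coord n} (hy : y ∈ (extChartAt (𝓡 n) x₀).target) {f : Coord n → ℝ}
    (hf : DifferentiableAt ℝ f y) :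
    ∑ i, fderiv ℝ (fun z => √(metricRep g x₀ z).det * f z * vecRep X x₀ z i) y (stdVec i) =
      √(metricRep g x₀ y).det *
        (fderiv ℝ f y (vecRep X x₀ y) + f y * (covMat g X x₀ y).trace) := by
  have hU := (isOpen_extChartAt_target (I := 𝓡 n) x₀).mem_nhds hy
  have hdet := ((contDiffOn_sqrt_det g x₀).contDiffAt hU).differentiableAt (by simp)
  have hXd : DifferentiableAt ℝ (vecRep X x₀) y :=
    ((h.contDiffOn hθ x₀).contDiffAt hU).differentiableAt (by simp)
  have hXk : ∀ k, HasFDerivAt (fun z => vecRep X x₀ z k)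
      ((EuclideanSpace.proj k : Coord n →L[ℝ] ℝ) ∘L fderiv ℝ (vecRep X x₀) y) y := fun k =>
    (EuclideanSpace.proj k : Coord n →L[ℝ] ℝ).hasFDerivAt.comp y hXd.hasFDerivAt
  have hterm : ∀ i, fderiv ℝ (fun z => √(metricRep g x₀ z).det * f z * vecRep X x₀ z i) y
      (stdVec i) = √(metricRep g x₀ y).det * f y * matOf (fderiv ℝ (vecRep X x₀) y) i i +
        vecRep X x₀ y i * fderiv ℝ (fun z => √(metricRep g x₀ z).det * f z) y (stdVec i) := by
    intro i
    rw [((hdet.fun_mul hf).hasFDerivAt.fun_mul (hXk i)).fderiv]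
    rfl
  have hsum : ∀ L : Coord n →L[ℝ] ℝ, ∑ i, vecRep X x₀ y i * L (stdVec i) = L (vecRep X x₀ y) := by
    intro L
    conv_rhs => rw [← sum_smul_stdVec (vecRep X x₀ y), map_sum]
    simp
  rw [Finset.sum_congr rfl fun i _ => hterm i, Finset.sum_add_distrib, hsum, ← Finset.mul_sum,
    fderiv_fun_mul hdet hf]
  have h3 := fderiv_sqrt_det h hθ hcl hy
  simp only [_root_.add_apply, _root_.smul_apply, smul_eq_mul]
  rw [h3, Matrix.trace_sub]
  have h4 : ∑ i, matOf (fderiv ℝ (vecRep X x₀) y) i i =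
    (matOf (fderiv ℝ (vecRep X x₀) y)).trace := rfl
  rw [h4]
  ring

variable [CompactSpace M] [MeasurableSpace M] [BorelSpace M]

/-- In the chart the integrand becomes a sum of partial derivatives of compactly supported functions
on ℝⁿ, each of integral zero. -/
theorem integral_dirDeriv_add_of_tsupport_subset (h : IsDual g θ X) (hθ : IsSmooth θ)
    (hcl : ∀ x, extDer θ x = 0) {f : M → ℝ} (hf : IsSmoothFun (n := n) f) {x₀ : M}
    (hs : tsupport f ⊆ (extChartAt (𝓡 n) x₀).source) :
    ∫ x, (dirDeriv X f x + f x * divergence g X x) ∂(riemannianVolume g) = 0 := by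
  set T := (extChartAt (𝓡 n) x₀).target with hT
  set φ := extChartAt (𝓡 n) x₀ with hφ
  have hTo : IsOpen T := isOpen_extChartAt_target x₀
  set K := φ '' tsupport f with hK
  have hKc : IsCompact K := (isClosed_tsupport f).isCompact.image_of_continuousOn
    ((continuousOn_extChartAt x₀).mono hs)
  have hKT : K ⊆ T := by
    rintro _ ⟨x, hx, rfl⟩
    exact φ.map_source (hs hx)
  have hfK : ∀ y ∈ T, y ∉ K → f (φ.symm y) = 0 := by
    intro y hy hyK
    by_contra hne
    exact hyK ⟨φ.symm y, subset_tsupport f hne, φ.right_inv hy⟩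
  -- The chart expressions mean nothing outside the target, hence the extension by zero. It is C¹
  -- everywhere because the expressions already vanish on the target off the compact set K.
  set F : Fin n → Coord n → ℝ := fun i => T.indicator fun y =>
    √(metricRep g x₀ y).det * (f ∘ φ.symm) y * vecRep X x₀ y i with hF
  have hFK : ∀ i, ∀ y ∉ K, F i y = 0 := by
    intro i y hy
    by_cases hyT : y ∈ T
    · simp only [hF, indicator_of_mem hyT, Function.comp_apply, hfK y hyT hy]
      ring
    · exact indicator_of_notMem hyT _
  have hFT : ∀ i, ∀ y ∈ T, F i =ᶠ[𝓝 y]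
      fun y => √(metricRep g x₀ y).det * (f ∘ φ.symm) y * vecRep X x₀ y i := by
    intro i y hy
    filter_upwards [hTo.mem_nhds hy] with z hz
    exact indicator_of_mem hz _
  have hF0 : ∀ i, ∀ y ∉ K, F i =ᶠ[𝓝 y] fun _ => 0 := by
    intro i y hy
    filter_upwards [hKc.isClosed.isOpen_compl.mem_nhds hy] with z hz
    exact hFK i z hz
  have hFd : ∀ i, ContDiff ℝ 1 (F i) := by
    intro i
    rw [contDiff_iff_contDiffAt]
    intro y
    by_cases hy : y ∈ T
    · refine ContDiffAt.congr_of_eventuallyEq ?_ (hFT i y hy)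
      have hn := hTo.mem_nhds hy
      refine ContDiffAt.of_le (n := ∞) ?_ (by simp)
      exact ((((contDiffOn_sqrt_det g x₀).contDiffAt hn).mul ((hf x₀).contDiffAt hn)).mul
        ((contDiffOn_euclidean.1 (h.contDiffOn hθ x₀) i).contDiffAt hn))
    · exact contDiffAt_const.congr_of_eventuallyEq (hF0 i y fun hyK => hy (hKT hyK))
  have hFc : ∀ i, HasCompactSupport (F i) := fun i => HasCompactSupport.intro hKc (hFK i)
  have hint : ∫ y, ∑ i, fderiv ℝ (F i) y (stdVec i) = 0 := by
    rw [integral_finsetSum]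
    · exact Finset.sum_eq_zero fun i _ => integral_fderiv_eq_zero (hFd i) (hFc i) _
    · intro i _
      refine Continuous.integrable_of_hasCompactSupport ?_ ?_
      · exact ((hFd i).continuous_fderiv one_ne_zero).clm_apply continuous_const
      · exact (hFc i).fderiv_apply ℝ _
  have hintT : ∫ y in T, ∑ i, fderiv ℝ (F i) y (stdVec i) = 0 := by
    rw [setIntegral_eq_integral_of_forall_compl_eq_zero, hint]
    intro y hy
    refine Finset.sum_eq_zero fun i _ => ?_
    rw [(hF0 i y fun hyK => hy (hKT hyK)).fderiv_eq]
    simp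
  have hcont : Continuous fun x => dirDeriv X f x + f x * divergence g X x :=
    (hf.continuous_dirDeriv (h.contDiffOn hθ)).add
      (hf.continuous.mul (continuous_divergence h hθ hcl))
  rw [integral_eq_integral_chart g x₀ hcont, ← hintT]
  · refine setIntegral_congr_fun hTo.measurableSet fun y hy => ?_
    have hx := φ.map_target hy
    have hd := sum_fderiv_density h hθ hcl hy (hf.differentiableAt hy)
    rw [Finset.sum_congr rfl fun i _ => by rw [(hFT i y hy).fderiv_eq], hd,
      dirDeriv_eq hf X hx, divergence_eq_trace h hθ hcl hx, φ.right_inv hy]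
    rfl
  · intro x hx
    have hx' : x ∉ tsupport f := fun h => hx (hs h)
    have h0 : f x = 0 := image_eq_zero_of_notMem_tsupport hx'
    have hev : f =ᶠ[𝓝 x] fun _ => 0 := notMem_tsupport_iff_eventuallyEq.1 hx'
    have hc : Tendsto (extChartAt (𝓡 n) x).symm (𝓝 (extChartAt (𝓡 n) x x)) (𝓝 x) := by
      have := (continuousAt_extChartAt_symm (I := 𝓡 n) x).tendsto
      rwa [extChartAt_to_inv] at this
    have hev' : f ∘ (extChartAt (𝓡 n) x).symm =ᶠ[𝓝 (extChartAt (𝓡 n) x x)] fun _ => 0 :=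
      hc.eventually hev
    rw [h0, zero_mul, add_zero, dirDeriv, hev'.fderiv_eq, fderiv_fun_const]
    rfl

/-- A partition of unity subordinate to finitely many chart domains reduces to functions supported
in one chart; the identity is linear in f. -/
theorem integral_dirDeriv_add [T2Space M] (h : IsDual g θ X) (hθ : IsSmooth θ)
    (hcl : ∀ x, extDer θ x = 0) {f : M → ℝ} (hf : IsSmoothFun (n := n) f) :
    ∫ x, (dirDeriv X f x + f x * divergence g X x) ∂(riemannianVolume g) = 0 := by
  obtain ⟨t, ht⟩ := isCompact_univ.elim_finite_subcover
    (fun x : M => (extChartAt (𝓡 n) x).source) (fun x => isOpen_extChartAt_source x)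
    fun x _ => mem_iUnion.2 ⟨x, mem_extChartAt_source x⟩
  obtain ⟨ρ, hρ⟩ := SmoothPartitionOfUnity.exists_isSubordinate (𝓡 n) isClosed_univ
    (fun x : t => (extChartAt (𝓡 n) (x : M)).source) (fun x => isOpen_extChartAt_source _)
    (fun x hx => by
      obtain ⟨i, hi, hxi⟩ := mem_iUnion₂.1 (ht hx)
      exact mem_iUnion.2 ⟨⟨i, hi⟩, hxi⟩)
  have hρs : ∀ i, IsSmoothFun (n := n) (ρ i) := fun i => isSmoothFun_of_contMDiff (ρ i).contMDiff
  have hρf : ∀ i, IsSmoothFun (n := n) fun x => ρ i x * f x := fun i => (hρs i).mul hf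
  have hsum : f = fun x => ∑ i, ρ i x * f x := by
    funext x
    rw [← Finset.sum_mul, ← finsum_eq_sum_of_fintype, ρ.sum_eq_one (mem_univ x), one_mul]
  have hpt : ∀ x, dirDeriv X f x + f x * divergence g X x = ∑ i,
      (dirDeriv X (fun x => ρ i x * f x) x + ρ i x * f x * divergence g X x) := by
    intro x
    rw [Finset.sum_add_distrib, ← dirDeriv_sum _ fun i _ => hρf i, ← hsum, ← Finset.sum_mul]
    congr 2
    exact congrFun hsum x
  simp only [hpt]
  rw [integral_finsetSum]
  · refine Finset.sum_eq_zero fun i _ =>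
      integral_dirDeriv_add_of_tsupport_subset h hθ hcl (hρf i)
        ((tsupport_mul_subset_left).trans (hρ i))
  · intro i _
    exact integrable_of_continuous g (((hρf i).continuous_dirDeriv (h.contDiffOn hθ)).add
      ((hρf i).continuous.mul (continuous_divergence h hθ hcl)))

end Divergence

end MorseNovikov

namespace MorseNovikov

/-! ### Harmonic forms and the integral estimate -/

section Harmonic

open Filter MeasureTheory

variable {n p : ℕ} {M : Type*} [TopologicalSpace M] [ChartedSpace (EuclideanSpace ℝ (Fin n)) M]
  [IsManifold (𝓡 n) ∞ M] {g : Metric n M} {θ : Form n M 1}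
  {X : (x : M) → TangentSpace (𝓡 n) x}

theorem formInner_zero_right (g : Metric n M) (α : Form n M p) (x : M) :
    formInner g α (fun _ => 0) x = 0 := by
  rw [formInner_comm]
  exact formInner_eq_zero_of_self (by simp [formInner]) α

/-- By adjointness the sum is ⟨d_θ α, θ ∧ α⟩, which vanishes where |d_θ α|² does. -/
theorem formInner_interiorMul_twistedD (h : IsDual g θ X) {α : Form n M p} {x : M}
    (hx : formInner g (twistedD θ α) (twistedD θ α) x = 0) :
    formInner g (interiorMul X (extDer α)) α x +
      formInner g (interiorMul X (wedge θ α)) α x = 0 := by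
  rw [← formInner_add_left]
  have h1 := formInner_wedge h α (twistedD θ α) x
  rw [formInner_comm, formInner_eq_zero_of_self hx, formInner_comm] at h1
  exact h1.symm

variable [CompactSpace M] [MeasurableSpace M] [BorelSpace M]

theorem integrable_formInner (g : Metric n M) {α β : Form n M p} (hα : IsSmooth α)
    (hβ : IsSmooth β) : Integrable (formInner g α β) (riemannianVolume g) :=
  integrable_of_continuous g (isSmoothFun_formInner g hα hβ).continuous

theorem ae_formInner_self_eq_zero {α : Form n M p} (hα : IsSmooth α)
    (h : ∫ x, formInner g α α x ∂(riemannianVolume g) = 0) :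
    ∀ᵐ x ∂(riemannianVolume g), formInner g α α x = 0 :=
  (integral_eq_zero_iff_of_nonneg (formInner_self_nonneg g α) (integrable_formInner g hα hα)).1 h

theorem IsHarmonic.ae_twistedD_zero {α : Form n M 0} (hθ : IsSmooth θ) (hα : IsHarmonic g θ α) :
    ∀ᵐ x ∂(riemannianVolume g), formInner g (twistedD θ α) (twistedD θ α) x = 0 := by
  refine ae_formInner_self_eq_zero (hθ.twistedD hα.1) ?_
  have h1 : IsAdjoint g θ (twistedD θ α) (fun _ => 0) := hα.2
  rw [h1.2 α hα.1]
  simp [formInner_zero_right]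

/-- With β = d_θ^* α and η = d_θ^* d_θ α, pairing d_θ β + η = 0 with α gives ‖β‖² + ‖d_θ α‖² = 0, a
sum of two nonnegative terms. -/
theorem IsHarmonic.ae_twistedD_succ {α : Form n M (p + 1)} (hθ : IsSmooth θ)
    (hα : IsHarmonic g θ α) :
    (∀ᵐ x ∂(riemannianVolume g), formInner g (twistedD θ α) (twistedD θ α) x = 0) ∧
      ∃ β : Form n M p, IsAdjoint g θ α β ∧
        ∀ᵐ x ∂(riemannianVolume g), formInner g β β x = 0 := by
  obtain ⟨hs, β, η, hβ, hη, h0⟩ := hα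
  -- Testing the two adjoint relations with α and with β produces the squares ‖d_θ α‖² and ‖β‖².
  have h1 := hη.2 α hs
  have h2 := hβ.2 β hβ.1
  have h3 : ∫ x, formInner g α η x ∂(riemannianVolume g) +
      ∫ x, formInner g (twistedD θ β) α x ∂(riemannianVolume g) = 0 := by
    rw [← integral_add (integrable_formInner g hs hη.1)
      (integrable_formInner g (hθ.twistedD hβ.1) hs)]
    refine integral_eq_zero_of_ae (ae_of_all _ fun x => ?_)
    change formInner g α η x + formInner g (twistedD θ β) α x = 0
    rw [formInner_comm g α η, add_comm, ← formInner_add_left, ← h0, formInner_comm,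
      formInner_zero_right]
  have h4 : 0 ≤ ∫ x, formInner g (twistedD θ α) (twistedD θ α) x ∂(riemannianVolume g) :=
    integral_nonneg (formInner_self_nonneg g _)
  have h5 : 0 ≤ ∫ x, formInner g β β x ∂(riemannianVolume g) :=
    integral_nonneg (formInner_self_nonneg g _)
  exact ⟨ae_formInner_self_eq_zero (hθ.twistedD hs) (by linarith), β, hβ,
    ae_formInner_self_eq_zero hβ.1 (by linarith)⟩

/-- The integrated identity behind the estimate. -/
theorem IsHarmonic.exists_integral_identity (h : IsDual g θ X) (hθ : IsSmooth θ)
    (hcl : ∀ x, extDer θ x = 0) {α : Form n M p} (hα : IsHarmonic g θ α) :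
    ∃ L : M → ℝ, Continuous L ∧
      (∀ x, L x = 2⁻¹ * dirDeriv X (formInner g α α) x + gradAction g X α x) ∧
      Continuous (fun x => g.inner x (X x) (X x) * formInner g α α x) ∧
      ∫ x, g.inner x (X x) (X x) * formInner g α α x ∂(riemannianVolume g) =
        -∫ x, L x ∂(riemannianVolume g) := by
  have hs := hα.1
  have hιd := h.isSmooth_interiorMul hθ hs.extDer
  have hιw := h.isSmooth_interiorMul hθ (hθ.wedge hs)
  have hc : ∀ {q : ℕ} {a b : Form n M q}, IsSmooth a → IsSmooth b → Continuous (formInner g a b) :=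
    fun ha hb => (isSmoothFun_formInner g ha hb).continuous
  cases p with
  | zero =>
    -- In degree zero ι_X α is absent, so L = ⟨ι_X dα, α⟩ and the identity already holds almost
    -- everywhere before integration.
    refine ⟨_, hc hιd hs, lie_identity_zero h hθ hcl hs, ?_, ?_⟩
    · exact (hc hιw hs).congr fun x => formInner_interiorMul_wedge_zero h α x
    · rw [← integral_neg]
      refine integral_congr_ae ?_
      filter_upwards [hα.ae_twistedD_zero hθ] with x hx
      have := formInner_interiorMul_twistedD h hx
      rw [formInner_interiorMul_wedge_zero h] at this
      linarith
  | succ p =>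
    obtain ⟨hd, β, hβ, hβ0⟩ := hα.ae_twistedD_succ hθ
    have hι := h.isSmooth_interiorMul hθ hs
    have hL := (hc hι.extDer hs).add (hc hιd hs)
    have hX : Continuous fun x => g.inner x (X x) (X x) * formInner g α α x :=
      ((hc hιw hs).add (hc hι hι)).congr fun x => formInner_interiorMul_wedge h α x
    refine ⟨_, hL, lie_identity h hθ hcl hs, hX, ?_⟩
    rw [eq_neg_iff_add_eq_zero,
      ← integral_add (integrable_of_continuous g hX) (integrable_of_continuous g hL)]
    -- In positive degree L is the full Cartan pairing; its part ⟨d ι_X α, α⟩ is controlled only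
    -- after integration, by using ι_X α as a test form against d_θ^* α = 0.
    have h1 : ∫ x, formInner g (twistedD θ (interiorMul X α)) α x ∂(riemannianVolume g) = 0 := by
      rw [hβ.2 _ hι]
      refine integral_eq_zero_of_ae ?_
      filter_upwards [hβ0] with x hx
      rw [formInner_comm, formInner_eq_zero_of_self hx]
      rfl
    rw [← h1]
    refine integral_congr_ae ?_
    filter_upwards [hd] with x hx
    have h2 := formInner_interiorMul_twistedD h hx
    have h3 := formInner_interiorMul_wedge h α x
    have h4 := formInner_add_left g (extDer (interiorMul X α)) (wedge θ (interiorMul X α)) α x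
    have h5 := formInner_wedge h (interiorMul X α) α x
    change _ = formInner g (fun x => extDer (interiorMul X α) x + wedge θ (interiorMul X α) x) α x
    simp only [Pi.add_apply]
    linarith

/-- Adding half of the divergence theorem for |α|² to -∫L cancels the derivative of |α|² and leaves
the integrand ½|α|² div X - ⟨∇X·α, α⟩. This is bounded pointwise with coefficient ½ for |div X| and
n² for |∇X|; n² + 1 covers both. -/
theorem IsHarmonic.integral_le [T2Space M] (h : IsDual g θ X) (hθ : IsSmooth θ)
    (hcl : ∀ x, extDer θ x = 0) {α : Form n M p} (hα : IsHarmonic g θ α) :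
    ∫ x, g.inner x (X x) (X x) * formInner g α α x ∂(riemannianVolume g) ≤
      ((n : ℝ) ^ 2 + 1) * ∫ x, (gradNorm g X x + |divergence g X x|) * formInner g α α x
        ∂(riemannianVolume g) := by
  obtain ⟨L, hLc, hL, -, hint⟩ := hα.exists_integral_identity h hθ hcl
  have hN := isSmoothFun_formInner g hα.1 hα.1
  have hdiv := continuous_divergence h hθ hcl
  have hD : Continuous fun x => 2⁻¹ * (dirDeriv X (formInner g α α) x +
      formInner g α α x * divergence g X x) :=
    continuous_const.mul
      ((hN.continuous_dirDeriv (h.contDiffOn hθ)).add (hN.continuous.mul hdiv))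
  have hD0 := integral_dirDeriv_add h hθ hcl hN
  have h1 : -∫ x, L x ∂(riemannianVolume g) = ∫ x, (2⁻¹ * (dirDeriv X (formInner g α α) x +
      formInner g α α x * divergence g X x) - L x) ∂(riemannianVolume g) := by
    rw [integral_sub (integrable_of_continuous g hD)
      (integrable_of_continuous g hLc), integral_const_mul, hD0, mul_zero, zero_sub]
  rw [hint, h1, ← integral_const_mul]
  refine integral_mono (integrable_of_continuous g (hD.sub hLc))
    (integrable_of_continuous g (continuous_const.mul
      (((continuous_gradNorm h hθ hcl).add hdiv.abs).mul hN.continuous))) fun x => ?_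
  have h2 := neg_le_of_abs_le (abs_gradAction_le h hθ hcl α x)
  have hf := formInner_self_nonneg g α x
  have hg : 0 ≤ gradNorm g X x := Real.sqrt_nonneg _
  have h3 : formInner g α α x * divergence g X x ≤ |divergence g X x| * formInner g α α x := by
    rw [mul_comm]
    exact mul_le_mul_of_nonneg_right (le_abs_self _) hf
  have h4 : 0 ≤ gradNorm g X x * formInner g α α x := mul_nonneg hg hf
  have h5 : 0 ≤ |divergence g X x| * formInner g α α x := mul_nonneg (abs_nonneg _) hf
  have h6 : 0 ≤ (n : ℝ) ^ 2 * (|divergence g X x| * formInner g α α x) := by positivity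
  simp only [hL]
  nlinarith

end Harmonic

end MorseNovikov

end

theorem corollary4p2 (n : ℕ) :
    ∃ C : ℝ, ∀ (M : Type*) [TopologicalSpace M] [ChartedSpace (EuclideanSpace ℝ (Fin n)) M]
      [IsManifold (𝓡 n) ∞ M] [CompactSpace M] [T2Space M] [MeasurableSpace M] [BorelSpace M]
      (g : MorseNovikov.Metric n M)
      (θ : MorseNovikov.Form n M 1) (_ : MorseNovikov.IsSmooth θ)
      (_ : ∀ x, MorseNovikov.extDer θ x = 0)
      (X : (x : M) → TangentSpace (𝓡 n) x)
      (_ : ∀ (x : M) (v : TangentSpace (𝓡 n) x), g.inner x (X x) v = θ x (fun _ => v))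
      (p : ℕ) (α : MorseNovikov.Form n M p) (_ : MorseNovikov.IsHarmonic g θ α),
      ∫ x, g.inner x (X x) (X x) * MorseNovikov.formInner g α α x
          ∂(MorseNovikov.riemannianVolume g) ≤
        C * ∫ x, (MorseNovikov.gradNorm g X x + |MorseNovikov.divergence g X x|) *
          MorseNovikov.formInner g α α x ∂(MorseNovikov.riemannianVolume g) :=
  ⟨(n : ℝ) ^ 2 + 1, fun _ _ _ _ _ _ _ _ _ _ hθ hcl _ hX _ _ hα => hα.integral_le hX hθ hcl⟩
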